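/- **Setting.** Let $b_1,\dots,b_d$ be a basis of $\mathbb R^d$ and $Y$ the parallelepiped with these edges; "periodic" refers to the lattice generated by the $b_i$. Let $Y_1,Y_2$ be the parts in $Y$ of two periodic open sets with Lipschitz boundary and disjoint closures, $Y_3=Y\setminus(\overline{Y_1}\cup\overline{Y_2})$ and $\Gamma_\alpha=\overline{Y_\alpha}\cap\overline{Y_3}$, $\alpha=1,2$ (closures understood periodically). Let $n^3$ be the unit normal on $\Gamma_1\cup\Gamma_2$ outward from $Y_3$. Write $⨍_{Z}f=|Y|^{-1}\int_{Z}f$ for $Z\subset Y$ or $Z\subset\Gamma_\alpha$. $H^1_\#$ denotes periodic $H^1$-functions, ${\bf H}^1_\#(Y)=H^1_\#(Y)^d$, and $H^1_{\#0}(Y_3)$ those functions of $H^1_\#(Y_3)$ that have zero trace on $\Gamma_1\cup\Gamma_2$. We use $(\nabla u)_{ij}=\partial_ju_i$ and $e(u)=\frac12(\nabla u+(\nabla u)^T)$. Given are bounded measurable periodic fields: a stiffness tensor $D$ with major and minor symmetries, symmetric tensors $\sigma$ (effective stress) and $K$ (permeability), a pressure $p_0$; further a known increment with gradient $\nabla\bar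 u=\nabla_x\bar u^0+\nabla_y\bar u^1$, where $\nabla_x\bar u^0$ is a constant matrix and $\bar u^1\in{\bf H}^1_\#(Y)$ has bounded gradient. Put $$\mathbb A X=D\,\tfrac12(X+X^T)+X\sigma-p_0\big((\operatorname{tr}X)I-X^T\big),\qquad \bar B=(\nabla\cdot\bar u)I-(\nabla\bar u)^T,$$ $$M=K+(\nabla\cdot\bar u)K-K(\nabla\bar u)^T-(\nabla\bar u)K^T ,$$ and, for $l=1,2,3$ and $\alpha=1,2$, $$a(u,v)=⨍_Y\mathbb A\nabla u:\nabla v,\quad b_l(q,u)=⨍_{Y_l}q(\bar B+I):\nabla u,\quad c_l(p,q)=⨍_{Y_l}M\nabla p\cdot\nabla q,\quad g_3^\alpha(p)=⨍_{\Gamma_\alpha}M\nabla p\cdot n^3\,dS .$$ The flux $g_3^\alpha(p)$ is understood in the sense of normal traces: $M\nabla p$ is to have a weak divergence in $L^2(Y_3)$, and $g_3^\alpha(p)=⨍_{Y_3}\big(M\nabla p\cdot\nabla\varphi+\nabla\cdot(M\nabla p)\,\varphi\big)$ for every $\varphi\in H^1_\#(Y_3)$ with trace $1$ on $\Gamma_\alpha$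 and $0$ on the other interface. Let $\delta t>0$ and $\Pi^{ij}_k(y)=y_j\delta_{ik}$. Suppose that $(\omega^{ij},\pi^{ij})\in{\bf H}^1_\#(Y)\times H^1_{\#0}(Y_3)$, $(\omega^\alpha,\pi^\alpha)\in{\bf H}^1_\#(Y)\times H^1_\#(Y_3)$ with $\pi^\alpha=\delta_{\alpha\beta}$ on $\Gamma_\beta$ (traces), and $\eta^i_\alpha\in H^1_\#(Y_\alpha)$ satisfy $$a(\omega^{ij}+\Pi^{ij},v)-b_3(\pi^{ij},v)=0,\qquad b_3(q,\omega^{ij}+\Pi^{ij})+\delta t\,c_3(\pi^{ij},q)=0,$$ $$a(\omega^\alpha,v)-b_3(\pi^\alpha,v)=b_\alpha(1,v),\qquad b_3(q,\omega^\alpha)+\delta t\,c_3(\pi^\alpha,q)=0,$$ for all $v\in{\bf H}^1_\#(Y)$, $q\in H^1_{\#0}(Y_3)$, and $c_\alpha(\eta^i_\alpha+y_i,q)=0$ for all $q\in H^1_\#(Y_\alpha)$. Define $$\mathcal B^\alpha_{ij}=|Y|^{-1}\big[b_3(\pi^\alpha,\Pi^{ij})+b_\alpha(1,\Pi^{ij})-a(\omega^\alpha,\Pi^{ij})\big],\qquad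 \mathcal R^\alpha_{ij}=|Y|^{-1}\big[b_\alpha(1,\omega^{ij}+\Pi^{ij})+\delta t\,g_3^\alpha(\pi^{ij})\big],$$ $$\mathcal D_{ijkl}=|Y|^{-1}\big[a(\omega^{kl}+\Pi^{kl},\Pi^{ij})-b_3(\pi^{kl},\Pi^{ij})\big],\qquad \mathcal C^\alpha_{ij}=|Y|^{-1}c_\alpha(\eta_\alpha^i+y_i,\eta_\alpha^j+y_j),$$ $$\mathcal G^\alpha_\beta=|Y|^{-1}\big[g_3^\alpha(\pi^\beta)+(\delta t)^{-1}b_\alpha(1,\omega^\beta)\big].$$ **Claim.** The fluxes $g_3^\alpha(\pi^{ij})$ and $g_3^\alpha(\pi^\beta)$ exist and are uniquely determined, and $$\mathcal B^\alpha_{ij}=\mathcal R^\alpha_{ij}\qquad(\alpha=1,2;\ i,j=1,\dots,d).$$ If $M\nabla\pi^{ij}$ agrees a.e. in $Y_3$ with a periodic $C^1$ vector field $F$ on $\mathbb R^d$, the same identity holds with $g_3^\alpha(\pi^{ij})$ replaced by the classical surface integral $⨍_{\Gamma_\alpha}F\cdot n^3\,dS$; here $n^3$ is characterised by the divergence formula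 $\int_{Y_3}\nabla\cdot\Phi=\int_{\Gamma_1\cup\Gamma_2}\Phi\cdot n^3\,dS$ for periodic $C^1$ fields $\Phi$ (and the interfaces have finite area). Moreover $\mathcal D_{ijkl}=\mathcal D_{klij}$, $\mathcal G^\alpha_\beta=\mathcal G^\beta_\alpha$, $\mathcal C^\alpha_{ij}=\mathcal C^\alpha_{ji}$. Consequently the homogenized incremental system is symmetric: if $\Omega\subset\mathbb R^d$ is open and such cell data and responses are given for every $x\in\Omega$ (with the same $\delta t$), then the bilinear form $$\int_\Omega\Big[\big(\mathcal D\nabla u-\sum_\alpha p_\alpha\mathcal B^\alpha\big):\nabla v-\sum_\alpha\Big(q_\alpha\big(\mathcal R^\alpha:\nabla u+\delta t\sum_\beta\mathcal G^\alpha_\beta p_\beta\big)+\delta t\,\mathcal C^\alpha\nabla p_\alpha\cdot\nabla q_\alpha\Big)\Big]dx$$ of the arguments $(u,p_1,p_2),(v,q_1,q_2)\in H^1(\Omega)^d\times H^1(\Omega)^2$ (the left-hand side of the homogenized equilibrium equation minus those of the two diffusion equations) does not change when the two arguments are exchanged. -/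

import Mathlib

open MeasureTheory Set Filter Topology Matrix
open scoped ContDiff

noncomputable section

namespace Poro

/-- Points and vectors of `ℝ^d` with the Euclidean norm. -/
abbrev Vec (d : ℕ) := EuclideanSpace ℝ (Fin d)

/-- Second order tensors. For a vector field `u`, `∇u` has the entries `(∇u)_{ij} = ∂_j u_i`. -/
abbrev Tensor (d : ℕ) := Matrix (Fin d) (Fin d) ℝ

/-- Scalar product `A : B` of second order tensors. -/
def frob {d : ℕ} (A B : Tensor d) : ℝ := ∑ i, ∑ j, A i j * B i j

/-- Symmetric part of a tensor; `symPart (∇u)` is the strain `e(u)`. -/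
def symPart {d : ℕ} (A : Tensor d) : Tensor d := (1 / 2 : ℝ) • (A + Aᵀ)

/-! ### Sobolev functions -/

/-- `g` is the weak gradient of `f` in the open set `U`. -/
def IsWeakGrad {d : ℕ} (U : Set (Vec d)) (f : Vec d → ℝ) (g : Vec d → Vec d) : Prop :=
  ∀ φ : Vec d → ℝ, ContDiff ℝ ∞ φ → HasCompactSupport φ → tsupport φ ⊆ U →
    ∀ i, ∫ y in U, f y * gradient φ y i = - ∫ y in U, g y i * φ y

/-- `D` is the weak divergence of the vector field `F` in the open set `U`. -/
def IsWeakDiv {d : ℕ} (U : Set (Vec d)) (F : Vec d → Vec d) (D : Vec d → ℝ) : Prop :=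
  ∀ φ : Vec d → ℝ, ContDiff ℝ ∞ φ → HasCompactSupport φ → tsupport φ ⊆ U →
    ∫ y in U, inner ℝ (F y) (gradient φ y) = - ∫ y in U, D y * φ y

/-- An element of `H¹(Ω)`, with its weak gradient. -/
structure H1 {d : ℕ} (Ω : Set (Vec d)) where
  val : Vec d → ℝ
  grad : Vec d → Vec d
  memLp_val : MemLp val 2 (volume.restrict Ω)
  memLp_grad : MemLp grad 2 (volume.restrict Ω)
  weak : IsWeakGrad Ω val grad

/-- `f` is periodic on the set `U` with respect to the lattice generated by `b`. -/
def PeriodicOn {d : ℕ} {β : Type*} (b : Module.Basis (Fin d) ℝ (Vec d)) (U : Set (Vec d))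
    (f : Vec d → β) : Prop :=
  ∀ i, ∀ y ∈ U, f (y + b i) = f y

/-- The reference cell `Y`: the parallelepiped with edges `b i` (with one face of each opposite
pair included, so that its translates by the lattice tile the space without overlap). -/
abbrev cell {d : ℕ} (b : Module.Basis (Fin d) ℝ (Vec d)) : Set (Vec d) :=
  ZSpan.fundamentalDomain b

/-- An element of `H¹_#(Y ∩ U)` for a lattice-periodic open set `U`, with its weak gradient: a
periodic function on `U` that has a weak gradient in all of `U` (so the values on opposite faces of
`Y` match) and is square integrable over one cell together with it. -/
structure PerH1 {d : ℕ} (b : Module.Basis (Fin d) ℝ (Vec d)) (U : Set (Vec d)) where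
  val : Vec d → ℝ
  grad : Vec d → Vec d
  per_val : PeriodicOn b U val
  per_grad : PeriodicOn b U grad
  memLp_val : MemLp val 2 (volume.restrict (cell b ∩ U))
  memLp_grad : MemLp grad 2 (volume.restrict (cell b ∩ U))
  weak : IsWeakGrad U val grad

/-- The gradient `∇u` of a periodic Sobolev vector field. -/
def jac {d : ℕ} {b : Module.Basis (Fin d) ℝ (Vec d)} {U : Set (Vec d)} (u : Fin d → PerH1 b U) :
    Vec d → Tensor d :=
  fun y => Matrix.of fun k l => (u k).grad y l

/-- Bounded measurable periodic scalar coefficient. -/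
def IsPerLinfty {d : ℕ} (b : Module.Basis (Fin d) ℝ (Vec d)) (f : Vec d → ℝ) : Prop :=
  PeriodicOn b univ f ∧ MemLp f ⊤ volume

/-- The open set `U` has Lipschitz boundary: near every boundary point it is, for some unit vector
`e`, the set below the graph (in direction `e`) of a Lipschitz function of the coordinates
orthogonal to `e`. -/
def HasLipschitzBoundary {d : ℕ} (U : Set (Vec d)) : Prop :=
  ∀ x ∈ frontier U, ∃ (e : Vec d) (r : ℝ) (L : NNReal) (γ : Vec d → ℝ),
    ‖e‖ = 1 ∧ 0 < r ∧ LipschitzWith L γ ∧ (∀ (y : Vec d) (t : ℝ), γ (y + t • e) = γ y) ∧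
    ∀ y ∈ Metric.ball x r, (y ∈ U ↔ inner ℝ y e < γ y)

/-! ### The microconfiguration -/

/-- Local microconfiguration: the periodic cell with the channels `Y₁, Y₂` and the data of the
current state. The sets `chan α` are the periodic extensions of the channels, so that
`Y_α = Y ∩ chan α`; all fields are extended periodically. -/
structure PoroCell (d : ℕ) where
  /-- edges of the cell -/
  basis : Module.Basis (Fin d) ℝ (Vec d)
  chan : Fin 2 → Set (Vec d)
  isOpen_chan : ∀ α, IsOpen (chan α)
  per_chan : ∀ α i y, y + basis i ∈ chan α ↔ y ∈ chan α
  lipschitz_chan : ∀ α, HasLipschitzBoundary (chan α)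
  disjoint_chan : Disjoint (closure (chan 0)) (closure (chan 1))
  /-- tangential stiffness `D^eff` -/
  elast : Vec d → Fin d → Fin d → Fin d → Fin d → ℝ
  elast_bdd : ∀ i j k l, IsPerLinfty basis fun y => elast y i j k l
  elast_major : ∀ y i j k l, elast y i j k l = elast y k l i j
  elast_minor : ∀ y i j k l, elast y i j k l = elast y j i k l
  /-- effective Cauchy stress `σ^eff` -/
  stress : Vec d → Tensor d
  stress_bdd : ∀ i j, IsPerLinfty basis fun y => stress y i j
  stress_symm : ∀ y, (stress y).IsSymm
  /-- fluid pressure of the current state -/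
  pres : Vec d → ℝ
  pres_bdd : IsPerLinfty basis pres
  /-- permeability, equal to `K^l` in the sector `Y_l` -/
  perm : Vec d → Tensor d
  perm_bdd : ∀ i j, IsPerLinfty basis fun y => perm y i j
  perm_symm : ∀ y, (perm y).IsSymm
  /-- macroscopic gradient `∇_x ū⁰` of the known displacement increment -/
  gradBar : Tensor d
  /-- microscopic part `ū¹` of the known displacement increment -/
  ubar : Fin d → PerH1 basis univ
  ubar_bdd : ∀ k l, MemLp (fun y => jac ubar y k l) ⊤ volume

namespace PoroCell

variable {d : ℕ} (C : PoroCell d)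

/-- The periodic extension of the matrix sector `Y₃ = Y \ (closure Y₁ ∪ closure Y₂)`. -/
def mat : Set (Vec d) := (closure (C.chan 0) ∪ closure (C.chan 1))ᶜ

/-- The (periodically extended) interface `Γ_α = closure Y_α ∩ closure Y₃`. -/
def iface (α : Fin 2) : Set (Vec d) := closure (C.chan α) ∩ closure C.mat

/-- The volume `|Y|`. -/
def vol : ℝ := volume.real (cell C.basis)

/-- The part of the sector `U` in one cell. -/
def part (U : Set (Vec d)) : Set (Vec d) := cell C.basis ∩ U

/-- The average integral `|Y|⁻¹ ∫_{Y ∩ U} f`. -/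
def avg (U : Set (Vec d)) (f : Vec d → ℝ) : ℝ := C.vol⁻¹ * ∫ y in C.part U, f y

/-- The surface measure of one period of `Γ_α`. -/
def dS (α : Fin 2) : Measure (Vec d) :=
  (Measure.euclideanHausdorffMeasure (d - 1)).restrict (C.part (C.iface α))

/-- `∇_x ū⁰ + ∇_y ū¹`. -/
def gradU (y : Vec d) : Tensor d := C.gradBar + jac C.ubar y

/-- `B(ū) = (∇·ū) I - (∇ū)ᵀ`. -/
def Bt (y : Vec d) : Tensor d := (C.gradU y).trace • (1 : Tensor d) - (C.gradU y)ᵀ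

/-- `K + H(ū)`, where `H(ū) = (∇·ū) K - K (∇ū)ᵀ - (∇ū) Kᵀ`. -/
def permH (y : Vec d) : Tensor d :=
  C.perm y + ((C.gradU y).trace • C.perm y - C.perm y * (C.gradU y)ᵀ - C.gradU y * (C.perm y)ᵀ)

/-- The tangent operator applied to a gradient `X`:
`𝔸 X = D^eff e(X) + X σ^eff - p ((tr X) I - Xᵀ)`. -/
def tangent (y : Vec d) (X : Tensor d) : Tensor d :=
  (Matrix.of fun i j => ∑ k, ∑ l, C.elast y i j k l * symPart X k l) + X * C.stress y
    - C.pres y • (X.trace • (1 : Tensor d) - Xᵀ)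

/-- `(K + H(ū)) P` for a vector field `P`. -/
def darcy (P : Vec d → Vec d) (y : Vec d) : Vec d :=
  WithLp.toLp 2 (C.permH y *ᵥ (P y).ofLp)

/-- The form `a(u, v)`, as a function of the gradients `X = ∇u`, `Z = ∇v`. -/
def aForm (X Z : Vec d → Tensor d) : ℝ := C.avg univ fun y => frob (C.tangent y (X y)) (Z y)

/-- The form `b_l(q, u)`, as a function of `q` and `X = ∇u`; `U` is the sector. -/
def bForm (U : Set (Vec d)) (q : Vec d → ℝ) (X : Vec d → Tensor d) : ℝ :=
  C.avg U fun y => q y * frob (C.Bt y + 1) (X y)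

/-- The form `c_l(p, q)`, as a function of the gradients `P = ∇p`, `Q = ∇q`; `U` is the sector. -/
def cForm (U : Set (Vec d)) (P Q : Vec d → Vec d) : ℝ :=
  C.avg U fun y => inner ℝ (C.darcy P y) (Q y)

/-- The space `H¹_#(Y)^d`. -/
abbrev Disp := Fin d → PerH1 C.basis univ

/-- The space `H¹_#(Y₃)`. -/
abbrev Pres := PerH1 C.basis C.mat

/-- `p ∈ H¹_#(Y₃)` has the constant trace `c β` on `Γ_β`, `β = 1, 2`: it is an `H¹`-limit of
smooth periodic functions whose restrictions to the interfaces converge to `c β` in `L²(Γ_β)`. -/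
def HasTrace (p : C.Pres) (c : Fin 2 → ℝ) : Prop :=
  ∃ φ : ℕ → Vec d → ℝ,
    (∀ n, ContDiff ℝ ∞ (φ n) ∧ PeriodicOn C.basis univ (φ n)) ∧
    Tendsto (fun n => eLpNorm (fun y => φ n y - p.val y) 2 (volume.restrict (C.part C.mat)))
      atTop (𝓝 0) ∧
    Tendsto (fun n => eLpNorm (fun y => gradient (φ n) y - p.grad y) 2
      (volume.restrict (C.part C.mat))) atTop (𝓝 0) ∧
    ∀ β, Tendsto (fun n => eLpNorm (fun y => φ n y - c β) 2 (C.dS β)) atTop (𝓝 0)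

/-- Kronecker symbol, as the family of interface values of `π^α`. -/
def kron (α : Fin 2) : Fin 2 → ℝ := Pi.single α 1

/-! ### Interface fluxes -/

/-- `g = |Y|⁻¹ ∫_{Γ_α} (K³ + H(ū)) ∇p · n³ dS` in the sense of normal traces: the field
`F = (K³ + H(ū)) ∇p` has a weak divergence `D ∈ L²` and `g` is the value of its normal trace
(an element of the dual of the space of traces) on the function that is `1` on `Γ_α` and `0` on the
other interface. -/
def IsFlux (p : C.Pres) (α : Fin 2) (g : ℝ) : Prop :=
  ∃ D : Vec d → ℝ, PeriodicOn C.basis C.mat D ∧ MemLp D 2 (volume.restrict (C.part C.mat)) ∧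
    IsWeakDiv C.mat (C.darcy p.grad) D ∧
    ∀ φ : C.Pres, C.HasTrace φ (kron α) →
      C.avg C.mat (fun y => inner ℝ (C.darcy p.grad y) (φ.grad y) + D y * φ.val y) = g

/-- The interface flux `g₃^α(ū; p)`, normalised like the other forms by `|Y|⁻¹`. -/
def flux (p : C.Pres) (α : Fin 2) : ℝ := Classical.epsilon (C.IsFlux p α)

/-- `n` is the unit normal on `Γ₁ ∪ Γ₂` outward from `Y₃`, as the density of minus the
distributional gradient of the indicator function of `Y₃` (on the torus) with respect to the
surface measure. -/
def IsOuterNormal (n : Vec d → Vec d) : Prop :=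
  (∀ α, C.dS α univ < ⊤) ∧
  (∀ α, AEStronglyMeasurable n (C.dS α) ∧ ∀ᵐ y ∂(C.dS α), ‖n y‖ = 1) ∧
  ∀ Φ : Vec d → Vec d, ContDiff ℝ 1 Φ → PeriodicOn C.basis univ Φ →
    ∫ y in C.part C.mat, LinearMap.trace ℝ (Vec d) (fderiv ℝ Φ y).toLinearMap
      = ∑ α, ∫ y, inner ℝ (Φ y) (n y) ∂(C.dS α)

/-- The surface integral `|Y|⁻¹ ∫_{Γ_α} F · n dS` of a continuous vector field. -/
def surfaceFlux (F n : Vec d → Vec d) (α : Fin 2) : ℝ :=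
  C.vol⁻¹ * ∫ y, inner ℝ (F y) (n y) ∂(C.dS α)

/-! ### Cell problems -/

/-- The displacement `Π^{ij}`, `Π^{ij}_k = y_j δ_{ik}`. -/
def Pi (i j : Fin d) (y : Vec d) : Vec d := EuclideanSpace.single i (y j)

/-- The gradient `∇_y Π^{ij}`. -/
def gradPi (i j : Fin d) (y : Vec d) : Tensor d :=
  Matrix.of fun k l => fderiv ℝ (Pi i j) y (EuclideanSpace.single l 1) k

/-- The characteristic responses of a cell. -/
structure Responses where
  /-- `ω^{ij}` -/
  om : Fin d → Fin d → C.Disp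
  /-- `π^{ij}` -/
  pi : Fin d → Fin d → C.Pres
  /-- `ω^α` -/
  omA : Fin 2 → C.Disp
  /-- `π^α` -/
  piA : Fin 2 → C.Pres
  /-- `η_α^i` -/
  eta : (α : Fin 2) → Fin d → PerH1 C.basis (C.chan α)

namespace Responses

variable {C} (S : C.Responses) (dt : ℝ)

/-- `∇(ω^{ij} + Π^{ij})`. -/
def gradOm (i j : Fin d) (y : Vec d) : Tensor d := jac (S.om i j) y + gradPi i j y

/-- `∇(η_α^i + y_i)`. -/
def gradEta (α : Fin 2) (i : Fin d) (y : Vec d) : Vec d :=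
  (S.eta α i).grad y + EuclideanSpace.single i 1

/-- The problem of the pair `(ω^{ij}, π^{ij})`. -/
def SolvesStrain (i j : Fin d) : Prop :=
  C.HasTrace (S.pi i j) 0 ∧
  (∀ v : C.Disp, C.aForm (S.gradOm i j) (jac v) - C.bForm C.mat (S.pi i j).val (jac v) = 0) ∧
  ∀ q : C.Pres, C.HasTrace q 0 →
    C.bForm C.mat q.val (S.gradOm i j) + dt * C.cForm C.mat (S.pi i j).grad q.grad = 0

/-- The problem of the pair `(ω^α, π^α)`. -/
def SolvesPressure (α : Fin 2) : Prop :=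
  C.HasTrace (S.piA α) (kron α) ∧
  (∀ v : C.Disp, C.aForm (jac (S.omA α)) (jac v) - C.bForm C.mat (S.piA α).val (jac v)
    = C.bForm (C.chan α) 1 (jac v)) ∧
  ∀ q : C.Pres, C.HasTrace q 0 →
    C.bForm C.mat q.val (jac (S.omA α)) + dt * C.cForm C.mat (S.piA α).grad q.grad = 0

/-- The channel flow problem of `η_α^i`. -/
def SolvesChannel (α : Fin 2) (i : Fin d) : Prop :=
  ∀ q : PerH1 C.basis (C.chan α), C.cForm (C.chan α) (S.gradEta α i) q.grad = 0

/-- The responses solve the cell problems with the time step `dt`. -/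
def Solves : Prop :=
  (∀ i j, S.SolvesStrain dt i j) ∧ (∀ α, S.SolvesPressure dt α) ∧ ∀ α i, S.SolvesChannel α i

/-! ### Homogenized coefficients -/

/-- The viscoelastic tensor `𝒟_{ijkl}`. -/
def coefD (i j k l : Fin d) : ℝ :=
  C.vol⁻¹ * (C.aForm (S.gradOm k l) (gradPi i j) - C.bForm C.mat (S.pi k l).val (gradPi i j))

/-- The Biot poroelasticity tensor `ℬ^α_{ij}`. -/
def coefB (α : Fin 2) (i j : Fin d) : ℝ :=
  C.vol⁻¹ * (C.bForm C.mat (S.piA α).val (gradPi i j) + C.bForm (C.chan α) 1 (gradPi i j)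
    - C.aForm (jac (S.omA α)) (gradPi i j))

/-- The adjoint Biot poroelasticity tensor `ℛ^α_{ij}`. -/
def coefR (α : Fin 2) (i j : Fin d) : ℝ :=
  C.vol⁻¹ * (C.bForm (C.chan α) 1 (S.gradOm i j) + dt * C.flux (S.pi i j) α)

/-- The channel permeability `𝒞^α_{ij}`. -/
def coefC (α : Fin 2) (i j : Fin d) : ℝ :=
  C.vol⁻¹ * C.cForm (C.chan α) (S.gradEta α i) (S.gradEta α j)

/-- The inter-channel permeability `𝒢^α_β`. -/
def coefG (α β : Fin 2) : ℝ :=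
  C.vol⁻¹ * (C.flux (S.piA β) α + dt⁻¹ * C.bForm (C.chan α) 1 (jac (S.omA β)))

/-- Integrand of the left hand side of the homogenized equilibrium equation; `X`, `p` stand for
`∇u⁰`, `p⁰` and `Z` for the gradient of the test function. -/
def equilibrium (X : Tensor d) (p : Fin 2 → ℝ) (Z : Tensor d) : ℝ :=
  (∑ i, ∑ j, ∑ k, ∑ l, S.coefD i j k l * X k l * Z i j)
    - ∑ α, p α * ∑ i, ∑ j, S.coefB α i j * Z i j

/-- Integrand of the left hand side of the homogenized diffusion equation in the channel `α`;
`X`, `p`, `P` stand for `∇u⁰`, `p⁰`, `∇p⁰` and `q`, `Q` for the test function and its gradient. -/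
def diffusion (α : Fin 2) (X : Tensor d) (p : Fin 2 → ℝ) (P : Fin 2 → Vec d) (q : ℝ) (Q : Vec d) :
    ℝ :=
  q * ((∑ i, ∑ j, S.coefR dt α i j * X i j) + dt * ∑ β, S.coefG dt α β * p β)
    + dt * ∑ i, ∑ j, S.coefC α i j * P α j * Q i

end Responses

end PoroCell

/-- The bilinear form of the homogenized incremental system on `H¹(Ω)^d × H¹(Ω)²`: the left hand
side of the equilibrium equation tested by `v` minus those of the two diffusion equations tested by
`q_1`, `q_2`. The microconfiguration `C x` may vary with the macroscopic position. -/
def macroForm {d : ℕ} {Ω : Set (Vec d)} (C : Vec d → PoroCell d) (S : ∀ x, (C x).Responses)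
    (dt : ℝ) (u : Fin d → H1 Ω) (p : Fin 2 → H1 Ω) (v : Fin d → H1 Ω) (q : Fin 2 → H1 Ω) : ℝ :=
  ∫ x in Ω,
    ((S x).equilibrium (Matrix.of fun i j => (u i).grad x j) (fun α => (p α).val x)
        (Matrix.of fun i j => (v i).grad x j)
      - ∑ α, (S x).diffusion dt α (Matrix.of fun i j => (u i).grad x j) (fun β => (p β).val x)
          (fun β => (p β).grad x) ((q α).val x) ((q α).grad x))

end Poro

end

/-! The statement is a reciprocity relation: the forms `aForm` and `cForm` are symmetric, and each
cell problem is tested with the solutions of the others. Symmetry of a follows pointwise from the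
symmetries of the stiffness and of the stress; symmetry of c holds because the terms $K(\nabla\bar
u)^T$ and $(\nabla\bar u)K^T$ are transposes of each other (`tangent_symm`, `permH_symm`).

The obstruction is that $\pi^\alpha$ has trace 1 on $\Gamma_\alpha$ and so is not admissible in the
diffusion equation of $\pi^{ij}$. The defect is exactly the interface flux. Test functions supported
in the matrix sector show that $M\nabla\pi^{ij}$ has weak divergence $\delta t^{-1}(\bar
B+I):\nabla(\omega^{ij}+\Pi^{ij})$. Hence the flux equals $c_3(\pi^{ij},\varphi)+\delta
t^{-1}b_3(\varphi,\omega^{ij}+\Pi^{ij})$ for any $\varphi$ with the prescribed traces; two choices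
differ by a function of zero trace, on which the expression vanishes (`isFlux_iff`, `flux_eq`). The
choice $\varphi=\pi^\alpha$ proves existence and uniqueness of the flux and expresses it by the cell
forms. The same argument covers $\pi^\beta$.

With this formula $\mathcal R^\alpha_{ij}-\mathcal B^\alpha_{ij}$ becomes, up to the volume factor,
$a(\omega^\alpha,\omega^{ij}+\Pi^{ij})+\delta t\,c_3(\pi^{ij},\pi^\alpha)$, which is zero by the
equilibrium equation of $\omega^{ij}$ tested with $\omega^\alpha$ and the diffusion equation of
$\pi^\alpha$ tested with $\pi^{ij}$ (`coefB_eq_coefR`). The tensors $\mathcal D$ and $\mathcal G$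
are likewise rewritten as visibly symmetric energies (`coefD_eq`, `coefG_eq`).

For a $C^1$ flux field the classical surface integral is recovered by applying the divergence
formula to $\psi_kF$, where the smooth $\psi_k$ approximate $\pi^\alpha$ (`surfaceFlux_eq_avg`). -/

noncomputable section

namespace Poro

/-! ### Lattice-periodic functions, periodization and unfolding of integrals. -/

section Lattice

variable {d : ℕ} {b : Module.Basis (Fin d) ℝ (Vec d)} {U : Set (Vec d)}

/-- The lattice generated by `b`. -/
abbrev lattice (b : Module.Basis (Fin d) ℝ (Vec d)) : Submodule ℤ (Vec d) :=
  Submodule.span ℤ (range b)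

/-- The set `U` is invariant under translations by the basis vectors. -/
def PeriodicSet (b : Module.Basis (Fin d) ℝ (Vec d)) (U : Set (Vec d)) : Prop :=
  ∀ i y, y + b i ∈ U ↔ y ∈ U

theorem PeriodicOn.add_lattice {β : Type*} {f : Vec d → β} (hf : PeriodicOn b univ f)
    {l : Vec d} (hl : l ∈ lattice b) : ∀ y, f (y + l) = f y := by
  induction hl using Submodule.span_induction with
  | mem x hx => obtain ⟨i, rfl⟩ := hx; exact fun y => hf i y (mem_univ y)
  | zero => simp
  | add x z _ _ hx hz => intro y; rw [← add_assoc, hz, hx]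
  | smul a x _ hx =>
    induction a with
    | zero => simp
    | succ n ih => intro y; rw [add_smul, one_smul, ← add_assoc, hx, ih]
    | pred n ih =>
      intro y
      rw [← hx, sub_smul, one_smul, add_assoc, sub_add_cancel, ih]

theorem PeriodicSet.add_lattice (hU : PeriodicSet b U) {l : Vec d} (hl : l ∈ lattice b)
    (y : Vec d) : y + l ∈ U ↔ y ∈ U :=
  iff_of_eq (PeriodicOn.add_lattice (f := fun y => y ∈ U) (fun i y _ => propext (hU i y)) hl y)

theorem PeriodicOn.indicator {β : Type*} [Zero β] {f : Vec d → β} (hU : PeriodicSet b U)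
    (hf : PeriodicOn b U f) : PeriodicOn b univ (U.indicator f) := by
  intro i y _
  by_cases hy : y ∈ U
  · rw [indicator_of_mem hy, indicator_of_mem ((hU i y).2 hy), hf i y hy]
  · rw [indicator_of_notMem hy, indicator_of_notMem (fun h => hy ((hU i y).1 h))]

theorem PeriodicSet.closure (hU : PeriodicSet b U) : PeriodicSet b (closure U) := by
  intro i y
  have h : (Homeomorph.addRight (b i)) ⁻¹' U = U := by
    ext z; exact hU i z
  have h2 := (Homeomorph.addRight (b i)).preimage_closure U
  rw [h] at h2
  exact iff_of_eq (congrArg (y ∈ ·) h2)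

theorem isBounded_cell (b : Module.Basis (Fin d) ℝ (Vec d)) : Bornology.IsBounded (cell b) :=
  ZSpan.fundamentalDomain_isBounded b

theorem measurableSet_cell (b : Module.Basis (Fin d) ℝ (Vec d)) : MeasurableSet (cell b) :=
  ZSpan.fundamentalDomain_measurableSet b

theorem volume_cell_lt_top (b : Module.Basis (Fin d) ℝ (Vec d)) : volume (cell b) < ⊤ :=
  (isBounded_cell b).measure_lt_top

open scoped Pointwise in
/-- Only finitely many lattice translates of a bounded set meet another one. -/
theorem exists_finset_lattice {K V : Set (Vec d)} (hK : Bornology.IsBounded K)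
    (hV : Bornology.IsBounded V) :
    ∃ L : Finset (lattice b), ∀ y ∈ V, ∀ l : lattice b, y + (l : Vec d) ∈ K → l ∈ L := by
  -- If `y ∈ V` and `y + l ∈ K`, then `l` lies in the bounded set `K - V`, which contains only
  -- finitely many lattice points.
  have hfin := ZSpan.setFinite_inter b (hK.sub hV)
  have hfin2 : {l : lattice b | (l : Vec d) ∈ K - V}.Finite := by
    refine Finite.of_finite_image (f := Subtype.val) (hfin.subset ?_) Subtype.val_injective.injOn
    rintro _ ⟨l, hl, rfl⟩
    exact ⟨hl, l.2⟩
  refine ⟨hfin2.toFinset, fun y hy l hl => ?_⟩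
  rw [Finite.mem_toFinset]
  exact ⟨y + l, hl, y, hy, by simp⟩

/-- A periodic function that is integrable over a cell is integrable over bounded sets. -/
theorem PeriodicOn.integrableOn_of_isBounded {E : Type*} [NormedAddCommGroup E] {f : Vec d → E}
    (hf : PeriodicOn b univ f) (hi : IntegrableOn f (cell b)) {K : Set (Vec d)}
    (hK : Bornology.IsBounded K) : IntegrableOn f K := by
  obtain ⟨L, hL⟩ := exists_finset_lattice (b := b) (isBounded_cell b) hK
  -- Every point has a lattice translate in the cell, and for points of `K` finitely many
  -- translations suffice.
  have hcov : K ⊆ ⋃ l ∈ (L : Set (lattice b)), (fun y => y + (l : Vec d)) ⁻¹' cell b := by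
    intro y hy
    obtain ⟨l, hl, -⟩ := ZSpan.exist_unique_vadd_mem_fundamentalDomain b y
    have hl' : y + (l : Vec d) ∈ cell b := by
      rwa [add_comm]
    exact mem_biUnion (hL y hy l hl') hl'
  refine IntegrableOn.mono_set ?_ hcov
  rw [integrableOn_finite_biUnion L.finite_toSet]
  intro l _
  have h := (measurePreserving_add_right (volume : Measure (Vec d)) (l : Vec d)).integrableOn_comp_preimage
    (measurableEmbedding_addRight (l : Vec d)) (f := f) (s := cell b)
  rw [← h] at hi
  convert hi using 1
  ext y
  exact (hf.add_lattice l.2 y).symm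

/-- Extension by zero outside the periodic set `U` reduces this to functions periodic on the whole
space. -/
theorem PeriodicOn.integrableOn_inter {E : Type*} [NormedAddCommGroup E] {f : Vec d → E}
    (hU : PeriodicSet b U) (hUm : MeasurableSet U) (hf : PeriodicOn b U f)
    (hi : IntegrableOn f (cell b ∩ U)) {K : Set (Vec d)} (hK : Bornology.IsBounded K) :
    IntegrableOn f (K ∩ U) := by
  have h := (hf.indicator hU).integrableOn_of_isBounded
    (by rw [IntegrableOn, integrable_indicator_iff hUm, IntegrableOn, Measure.restrict_restrict hUm,
          inter_comm]; exact hi) hK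
  rwa [IntegrableOn, integrable_indicator_iff hUm, IntegrableOn, Measure.restrict_restrict hUm,
    inter_comm] at h

theorem PeriodicOn.locallyIntegrableOn {E : Type*} [NormedAddCommGroup E] {f : Vec d → E}
    (hU : PeriodicSet b U) (hUo : IsOpen U) (hf : PeriodicOn b U f)
    (hi : IntegrableOn f (cell b ∩ U)) : LocallyIntegrableOn f U := by
  rw [locallyIntegrableOn_iff hUo.isLocallyClosed]
  intro K hKU hK
  have := hf.integrableOn_inter hU hUo.measurableSet hi hK.isBounded
  rwa [inter_eq_left.2 hKU] at this

/-- The periodization of a function. -/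
def periodize {E : Type*} [NormedAddCommGroup E] (b : Module.Basis (Fin d) ℝ (Vec d))
    (g : Vec d → E) (y : Vec d) : E :=
  ∑' l : lattice b, g (y + l)

section periodize

variable {E : Type*} [NormedAddCommGroup E] {g : Vec d → E}

/-- One finite index set serves all points of `V`; regularity, differentiation and integration of
the periodization thereby reduce to finite sums. -/
theorem exists_finset_periodize (hg : HasCompactSupport g) {V : Set (Vec d)}
    (hV : Bornology.IsBounded V) :
    ∃ L : Finset (lattice b), (∀ y ∈ V, ∀ l ∉ L, g (y + (l : Vec d)) = 0) ∧
      ∀ y ∈ V, periodize b g y = ∑ l ∈ L, g (y + l) := by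
  obtain ⟨L, hL⟩ := exists_finset_lattice (b := b) hg.isCompact.isBounded hV
  have h : ∀ y ∈ V, ∀ l ∉ L, g (y + (l : Vec d)) = 0 := fun y hy l hl =>
    image_eq_zero_of_notMem_tsupport fun h => hl (hL y hy l h)
  exact ⟨L, h, fun y hy => tsum_eq_sum fun l hl => h y hy l hl⟩

theorem periodicOn_periodize (g : Vec d → E) : PeriodicOn b univ (periodize b g) := by
  intro i y _
  have hi : b i ∈ lattice b := Submodule.subset_span (mem_range_self i)
  rw [periodize, periodize,
    ← (Equiv.addLeft (⟨b i, hi⟩ : lattice b)).tsum_eq (fun l : lattice b => g (y + l))]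
  simp [add_assoc]

theorem periodize_eq_zero (hU : PeriodicSet b U) (hg : tsupport g ⊆ U) {y : Vec d} (hy : y ∉ U) :
    periodize b g y = 0 := by
  have h : ∀ l : lattice b, g (y + l) = 0 := fun l =>
    image_eq_zero_of_notMem_tsupport fun h => hy ((hU.add_lattice l.2 y).1 (hg h))
  simp [periodize, h]

theorem eventuallyEq_periodize (hg : HasCompactSupport g) (y : Vec d) :
    ∃ L : Finset (lattice b), periodize b g =ᶠ[𝓝 y] fun z => ∑ l ∈ L, g (z + l) := by
  obtain ⟨L, -, hL⟩ := exists_finset_periodize (b := b) hg (Metric.isBounded_ball (x := y) (r := 1))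
  exact ⟨L, eventually_of_mem (Metric.ball_mem_nhds y one_pos) hL⟩

end periodize

theorem contDiff_periodize {φ : Vec d → ℝ} (hφ : ContDiff ℝ ∞ φ) (hc : HasCompactSupport φ) :
    ContDiff ℝ ∞ (periodize b φ) := by
  rw [contDiff_iff_contDiffAt]
  intro y
  obtain ⟨L, hL⟩ := eventuallyEq_periodize (b := b) hc y
  refine ContDiffAt.congr_of_eventuallyEq ?_ hL
  exact ContDiff.contDiffAt (ContDiff.sum fun l _ => hφ.comp (contDiff_id.add contDiff_const))

theorem hasCompactSupport_gradient {φ : Vec d → ℝ} (hc : HasCompactSupport φ) :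
    HasCompactSupport (gradient φ) :=
  (hc.fderiv (𝕜 := ℝ)).comp_left (g := (InnerProductSpace.toDual ℝ (Vec d)).symm) (map_zero _)

theorem tsupport_gradient_subset (φ : Vec d → ℝ) : tsupport (gradient φ) ⊆ tsupport φ := by
  refine (closure_mono ?_).trans (tsupport_fderiv_subset ℝ (f := φ))
  intro y hy h
  exact hy (by simp only [gradient, h, map_zero])

theorem gradient_periodize {φ : Vec d → ℝ} (hφ : ContDiff ℝ ∞ φ) (hc : HasCompactSupport φ) :
    gradient (periodize b φ) = periodize b (gradient φ) := by
  ext1 y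
  obtain ⟨L, hz, hL⟩ :=
    exists_finset_periodize (b := b) hc (Metric.isBounded_ball (x := y) (r := 1))
  have hev : periodize b φ =ᶠ[𝓝 y] fun z => ∑ l ∈ L, φ (z + l) :=
    eventually_of_mem (Metric.ball_mem_nhds y one_pos) hL
  have hd : ∀ z, DifferentiableAt ℝ φ z := fun z => hφ.differentiable (by simp) z
  -- For these `l` the translate vanishes on a whole ball around `y`, so its derivative at `y`
  -- vanishes too.
  have h0 : ∀ l ∉ L, gradient φ (y + (l : Vec d)) = 0 := by
    intro l hl
    have : (fun z => φ (z + (l : Vec d))) =ᶠ[𝓝 y] fun _ => 0 :=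
      eventually_of_mem (Metric.ball_mem_nhds y one_pos) fun z hz' => hz z hz' l hl
    have h1 := this.fderiv_eq (𝕜 := ℝ)
    rw [fderiv_comp_add_right] at h1
    simp [gradient, h1]
  rw [hev.gradient_eq, periodize, tsum_eq_sum h0, gradient, fderiv_fun_sum, map_sum]
  · simp only [fderiv_comp_add_right, gradient]
  · intro l _
    exact (hd _).comp y (differentiableAt_id.add_const _)

/-- Integration against a periodic function unfolds the periodization. -/
theorem integral_cell_inner_periodize {E : Type*} [NormedAddCommGroup E] [InnerProductSpace ℝ E]
    {f g : Vec d → E} (hf : PeriodicOn b univ f) (hi : IntegrableOn f (cell b))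
    (hg : Continuous g) (hc : HasCompactSupport g) :
    ∫ y in cell b, inner ℝ (f y) (periodize b g y) = ∫ y, inner ℝ (f y) (g y) := by
  obtain ⟨L, hz, hL⟩ := exists_finset_periodize (b := b) hc (isBounded_cell b)
  obtain ⟨c, hcb⟩ := hg.bounded_above_of_compact_support hc
  have hint : ∀ (K : Set (Vec d)) (l : Vec d), IntegrableOn f K →
      IntegrableOn (fun y => inner ℝ (f y) (g (y + l))) K := by
    intro K l hK
    refine Integrable.mono' (hK.norm.mul_const c)
      (hK.aestronglyMeasurable.inner (by fun_prop)) (Eventually.of_forall fun y => ?_)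
    exact (norm_inner_le_norm _ _).trans (by gcongr; exact hcb _)
  have hglob : Integrable (fun y => inner ℝ (f y) (g y)) := by
    have h1 := hint (tsupport g) 0 (hf.integrableOn_of_isBounded hi hc.isCompact.isBounded)
    simp only [add_zero] at h1
    rw [← integrableOn_iff_integrable_of_support_subset (s := tsupport g)]
    · exact h1
    · intro y hy
      by_contra h
      exact hy (by simp [image_eq_zero_of_notMem_tsupport h])
  have : VAddInvariantMeasure (lattice b) (Vec d) volume :=
    inferInstanceAs <| VAddInvariantMeasure (lattice b).toAddSubgroup (Vec d) volume
  -- The integral over the whole space is the sum of the integrals over the translated cells.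
  -- Periodicity of `f` moves the translation onto `g`, and only the indices in `L` contribute.
  rw [(ZSpan.isAddFundamentalDomain b (volume : Measure (Vec d))).integral_eq_tsum'' _ hglob]
  have hterm : ∀ l : lattice b, ∀ y, inner ℝ (f (l +ᵥ y)) (g (l +ᵥ y))
      = inner ℝ (f y) (g (y + (l : Vec d))) := by
    intro l y
    have : l +ᵥ y = y + (l : Vec d) := add_comm _ _
    rw [this, hf.add_lattice l.2]
  simp only [hterm]
  rw [tsum_eq_sum (s := L), ← integral_finsetSum]
  · refine setIntegral_congr_fun (measurableSet_cell b) fun y hy => ?_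
    simp only [hL y hy, inner_sum]
  · exact fun l _ => hint _ _ hi
  · intro l hl
    rw [setIntegral_congr_fun (g := fun _ => 0) (measurableSet_cell b) fun y hy => by
      simp only [hz y hy l hl, inner_zero_right]]
    simp

theorem integral_inter_inner_periodize {E : Type*} [NormedAddCommGroup E] [InnerProductSpace ℝ E]
    {f g : Vec d → E} (hU : PeriodicSet b U) (hUm : MeasurableSet U) (hf : PeriodicOn b U f)
    (hi : IntegrableOn f (cell b ∩ U)) (hg : Continuous g) (hc : HasCompactSupport g) :
    ∫ y in cell b ∩ U, inner ℝ (f y) (periodize b g y) = ∫ y in U, inner ℝ (f y) (g y) := by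
  have h := integral_cell_inner_periodize (hf.indicator hU)
    (by rw [IntegrableOn, integrable_indicator_iff hUm, IntegrableOn, Measure.restrict_restrict hUm,
          inter_comm]; exact hi) hg hc
  have hind : ∀ u : Vec d → E, (fun y => inner ℝ (U.indicator f y) (u y))
      = U.indicator fun y => inner ℝ (f y) (u y) := by
    intro u; ext y; by_cases hy : y ∈ U <;> simp [hy]
  rw [hind, hind, integral_indicator hUm, integral_indicator hUm, Measure.restrict_restrict hUm,
    inter_comm] at h
  exact h

end Lattice


/-! ### Weak gradients, weak divergences and periodic Sobolev functions. -/

section Sobolev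

variable {d : ℕ} {b : Module.Basis (Fin d) ℝ (Vec d)} {U : Set (Vec d)}

theorem gradient_apply (φ : Vec d → ℝ) (y : Vec d) (i : Fin d) :
    gradient φ y i = fderiv ℝ φ y (EuclideanSpace.single i 1) := by
  rw [← inner_gradient_left, EuclideanSpace.inner_single_right]
  simp

theorem continuous_gradient {φ : Vec d → ℝ} (hφ : ContDiff ℝ 1 φ) : Continuous (gradient φ) :=
  (InnerProductSpace.toDual ℝ (Vec d)).symm.continuous.comp (hφ.continuous_fderiv one_ne_zero)

theorem PeriodicOn.gradient {φ : Vec d → ℝ} (h : PeriodicOn b univ φ) :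
    PeriodicOn b univ (gradient φ) := by
  intro i y _
  have h1 : (fun z => φ (z + b i)) = φ := funext fun z => h i z (mem_univ z)
  have h2 := fderiv_comp_add_right (𝕜 := ℝ) (f := φ) (x := y) (b i)
  rw [h1] at h2
  simp only [_root_.gradient, h2]

/-- The test function vanishes outside `U`, so both integrals extend to the whole space and
integration by parts leaves no boundary term. -/
theorem isWeakGrad_gradient {f : Vec d → ℝ} (hf : ContDiff ℝ 1 f) :
    IsWeakGrad U f (gradient f) := by
  intro φ hφ hc hs i
  have hz : ∀ y, y ∉ U → φ y = 0 := fun y hy =>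
    image_eq_zero_of_notMem_tsupport fun h => hy (hs h)
  have hgz : ∀ y, y ∉ U → gradient φ y i = 0 := fun y hy => by
    rw [image_eq_zero_of_notMem_tsupport fun h => hy (hs (tsupport_gradient_subset φ h))]; rfl
  rw [setIntegral_eq_integral_of_forall_compl_eq_zero fun y hy => by rw [hgz y hy, mul_zero],
    setIntegral_eq_integral_of_forall_compl_eq_zero fun y hy => by rw [hz y hy, mul_zero]]
  simp only [gradient_apply]
  have hφ1 : ContDiff ℝ 1 φ := hφ.of_le (by norm_cast)
  have hdφ : Continuous fun y => fderiv ℝ φ y (EuclideanSpace.single i 1) :=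
    (hφ1.continuous_fderiv one_ne_zero).clm_apply continuous_const
  have hdf : Continuous fun y => fderiv ℝ f y (EuclideanSpace.single i 1) :=
    (hf.continuous_fderiv one_ne_zero).clm_apply continuous_const
  have hcd : HasCompactSupport fun y => fderiv ℝ φ y (EuclideanSpace.single i 1) :=
    (hc.fderiv (𝕜 := ℝ)).comp_left (g := fun A : Vec d →L[ℝ] ℝ => A (EuclideanSpace.single i 1))
      (by simp)
  refine integral_mul_fderiv_eq_neg_fderiv_mul_of_integrable ?_ ?_ ?_ ?_ ?_
  · exact (hdf.mul hφ.continuous).integrable_of_hasCompactSupport hc.mul_left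
  · exact (hf.continuous.mul hdφ).integrable_of_hasCompactSupport hcd.mul_left
  · exact (hf.continuous.mul hφ.continuous).integrable_of_hasCompactSupport hc.mul_left
  · exact fun y _ => hf.differentiable one_ne_zero y
  · exact fun y _ => hφ1.differentiable one_ne_zero y

/-- The divergence of a differentiable vector field. -/
def divergence (F : Vec d → Vec d) (y : Vec d) : ℝ :=
  LinearMap.trace ℝ (Vec d) (fderiv ℝ F y).toLinearMap

theorem divergence_eq_sum {F : Vec d → Vec d} (hF : ContDiff ℝ 1 F) (y : Vec d) :
    divergence F y = ∑ i, gradient (fun z => F z i) y i := by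
  rw [divergence, LinearMap.trace_eq_sum_inner _ (EuclideanSpace.basisFun (Fin d) ℝ)]
  refine Finset.sum_congr rfl fun i _ => ?_
  rw [gradient_apply]
  have h : HasFDerivAt (fun z => F z i)
      ((EuclideanSpace.proj i : Vec d →L[ℝ] ℝ).comp (fderiv ℝ F y)) y :=
    (EuclideanSpace.proj i : Vec d →L[ℝ] ℝ).hasFDerivAt.comp y
      (hF.differentiable one_ne_zero y).hasFDerivAt
  rw [h.fderiv]
  simp [EuclideanSpace.inner_single_left]

theorem continuous_divergence {F : Vec d → Vec d} (hF : ContDiff ℝ 1 F) :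
    Continuous (divergence F) := by
  have h : divergence F = fun y => ∑ i, gradient (fun z => F z i) y i :=
    funext (divergence_eq_sum hF)
  rw [h]
  refine continuous_finsetSum _ fun i _ => ?_
  exact (EuclideanSpace.proj i : Vec d →L[ℝ] ℝ).continuous.comp
    (continuous_gradient ((EuclideanSpace.proj i : Vec d →L[ℝ] ℝ).contDiff.comp hF))

theorem PeriodicOn.divergence {F : Vec d → Vec d} (h : PeriodicOn b univ F) :
    PeriodicOn b univ (divergence F) := by
  intro i y _
  have h1 : (fun z => F (z + b i)) = F := funext fun z => h i z (mem_univ z)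
  have h2 := fderiv_comp_add_right (𝕜 := ℝ) (f := F) (x := y) (b i)
  rw [h1] at h2
  simp only [Poro.divergence, h2]

/-- The derivative of the product contains, besides `f • DF`, a rank-one map whose trace is the
gradient term. -/
theorem divergence_smul {f : Vec d → ℝ} {F : Vec d → Vec d} (hf : ContDiff ℝ 1 f)
    (hF : ContDiff ℝ 1 F) (y : Vec d) :
    divergence (fun z => f z • F z) y = inner ℝ (F y) (gradient f y) + f y * divergence F y := by
  rw [divergence, fderiv_fun_smul (hf.differentiable one_ne_zero y)
    (hF.differentiable one_ne_zero y), inner_gradient_right, divergence]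
  have h : ((f y • fderiv ℝ F y + (fderiv ℝ f y).smulRight (F y) : Vec d →L[ℝ] Vec d) :
      Vec d →ₗ[ℝ] Vec d) = f y • (fderiv ℝ F y : Vec d →ₗ[ℝ] Vec d)
        + (fderiv ℝ f y : Vec d →ₗ[ℝ] ℝ).smulRight (F y) := rfl
  rw [h, map_add, map_smul, LinearMap.trace_smulRight]
  simp [add_comm]

/-- The pointwise divergence of a `C¹` field is its weak divergence. -/
theorem isWeakDiv_divergence {F : Vec d → Vec d} (hF : ContDiff ℝ 1 F) :
    IsWeakDiv U F (divergence F) := by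
  intro φ hφ hc hs
  have hφ1 : ContDiff ℝ 1 φ := hφ.of_le (by norm_cast)
  have hFi : ∀ i, ContDiff ℝ 1 fun z => F z i := fun i =>
    (EuclideanSpace.proj i : Vec d →L[ℝ] ℝ).contDiff.comp hF
  have hi1 : ∀ i, IntegrableOn (fun y => F y i * gradient φ y i) U := fun i => by
    refine Integrable.integrableOn (Continuous.integrable_of_hasCompactSupport ?_ ?_)
    · exact (hFi i).continuous.mul
        ((EuclideanSpace.proj i : Vec d →L[ℝ] ℝ).continuous.comp (continuous_gradient hφ1))
    · exact ((hasCompactSupport_gradient hc).comp_left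
        (g := fun v : Vec d => v i) rfl).mul_left
  have hi2 : ∀ i, IntegrableOn (fun y => gradient (fun z => F z i) y i * φ y) U := fun i => by
    refine Integrable.integrableOn (Continuous.integrable_of_hasCompactSupport ?_ hc.mul_left)
    exact ((EuclideanSpace.proj i : Vec d →L[ℝ] ℝ).continuous.comp
      (continuous_gradient (hFi i))).mul hφ.continuous
  calc ∫ y in U, inner ℝ (F y) (gradient φ y)
      = ∫ y in U, ∑ i, F y i * gradient φ y i := by
        simp only [PiLp.inner_apply, RCLike.inner_apply, conj_trivial, mul_comm]
    _ = ∑ i, ∫ y in U, F y i * gradient φ y i := integral_finsetSum _ fun i _ => hi1 i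
    _ = ∑ i, -∫ y in U, gradient (fun z => F z i) y i * φ y :=
        Finset.sum_congr rfl fun i _ => isWeakGrad_gradient (hFi i) φ hφ hc hs i
    _ = -∫ y in U, ∑ i, gradient (fun z => F z i) y i * φ y := by
        rw [integral_finsetSum _ fun i _ => hi2 i, Finset.sum_neg_distrib]
    _ = -∫ y in U, divergence F y * φ y := by
        simp only [divergence_eq_sum hF, Finset.sum_mul]

theorem IsWeakDiv.congr {F G : Vec d → Vec d} {D : Vec d → ℝ} (h : IsWeakDiv U F D)
    (hFG : ∀ᵐ y ∂(volume.restrict U), G y = F y) : IsWeakDiv U G D := by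
  intro φ hφ hc hs
  rw [← h φ hφ hc hs]
  refine integral_congr_ae ?_
  filter_upwards [hFG] with y hy
  rw [hy]

theorem integrableOn_mul_of_tsupport_subset {f φ : Vec d → ℝ} (hf : LocallyIntegrableOn f U)
    (hφ : Continuous φ) (hc : HasCompactSupport φ) (hs : tsupport φ ⊆ U) :
    IntegrableOn (fun y => f y * φ y) U := by
  have hK : IntegrableOn (fun y => f y * φ y) (tsupport φ) :=
    (hf.integrableOn_compact_subset hs hc.isCompact).mul_continuousOn
      hφ.continuousOn hc.isCompact
  refine Integrable.integrableOn ?_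
  rwa [← integrableOn_iff_integrable_of_support_subset (s := tsupport φ)]
  intro y hy
  by_contra h
  exact hy (by simp [image_eq_zero_of_notMem_tsupport h])

/-- The weak divergence is unique almost everywhere. -/
theorem IsWeakDiv.ae_eq {F : Vec d → Vec d} {D E : Vec d → ℝ} (hU : IsOpen U)
    (hD : IsWeakDiv U F D) (hE : IsWeakDiv U F E) (hDi : LocallyIntegrableOn D U)
    (hEi : LocallyIntegrableOn E U) : ∀ᵐ y ∂(volume.restrict U), D y = E y := by
  have hi : LocallyIntegrableOn (fun y => D y - E y) U := hDi.sub hEi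
  rw [ae_restrict_iff' hU.measurableSet]
  have h := hU.ae_eq_zero_of_integral_contDiff_smul_eq_zero hi (fun φ hφ hc hs => ?_)
  · filter_upwards [h] with y hy hyU
    exact sub_eq_zero.1 (hy hyU)
  · have hz : ∀ y, y ∉ U → φ y = 0 := fun y hy =>
      image_eq_zero_of_notMem_tsupport fun h => hy (hs h)
    have hprod : ∀ G : Vec d → ℝ, LocallyIntegrableOn G U →
        IntegrableOn (fun y => G y * φ y) U := fun G hG =>
      integrableOn_mul_of_tsupport_subset hG hφ.continuous hc hs
    rw [← setIntegral_eq_integral_of_forall_compl_eq_zero (s := U)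
      fun y hy => by rw [hz y hy, zero_smul]]
    have h1 : ∀ y, φ y • (D y - E y) = D y * φ y - E y * φ y := fun y => by
      simp only [smul_eq_mul]; ring
    simp only [h1]
    rw [integral_sub (hprod D hDi) (hprod E hEi), sub_eq_zero, ← neg_inj, ← hD φ hφ hc hs,
      ← hE φ hφ hc hs]

/-- The measure is left general so that the result applies to the volume and to the surface measure
alike. -/
theorem memLp_of_continuous {E : Type*} [NormedAddCommGroup E] {f : Vec d → E} (hf : Continuous f)
    {K : Set (Vec d)} (hK : Bornology.IsBounded K) (hKm : MeasurableSet K) (p : ENNReal)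
    (μ : Measure (Vec d)) (hμ : μ K < ⊤) : MemLp f p (μ.restrict K) := by
  have : IsFiniteMeasure (μ.restrict K) := ⟨by simpa using hμ⟩
  obtain ⟨c, hc⟩ := (hK.isCompact_closure.image hf).isBounded.exists_norm_le
  refine MemLp.of_bound hf.aestronglyMeasurable c ?_
  filter_upwards [ae_restrict_mem hKm] with y hy
  exact hc _ (mem_image_of_mem f (subset_closure hy))

theorem integrable_inner_of_memLp {E α : Type*} [NormedAddCommGroup E] [InnerProductSpace ℝ E]
    [MeasurableSpace α] {μ : Measure α} {f g : α → E} (hf : MemLp f 2 μ) (hg : MemLp g 2 μ) :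
    Integrable (fun y => inner ℝ (f y) (g y)) μ :=
  Integrable.mono' (hf.norm.integrable_mul hg.norm)
    (hf.aestronglyMeasurable.inner hg.aestronglyMeasurable)
    (Eventually.of_forall fun _ => norm_inner_le_norm _ _)

namespace PerH1

/-- A smooth periodic function as an element of the periodic Sobolev space. -/
def ofSmooth (hU : MeasurableSet U) {f : Vec d → ℝ} (hf : ContDiff ℝ ∞ f)
    (hp : PeriodicOn b univ f) : PerH1 b U where
  val := f
  grad := gradient f
  per_val := fun i y _ => hp i y (mem_univ y)
  per_grad := fun i y _ => hp.gradient i y (mem_univ y)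
  memLp_val := memLp_of_continuous hf.continuous ((isBounded_cell b).subset inter_subset_left)
    ((measurableSet_cell b).inter hU) 2 _
    ((measure_mono inter_subset_left).trans_lt (volume_cell_lt_top b))
  memLp_grad := memLp_of_continuous
    (continuous_gradient (hf.of_le (by norm_cast)))
    ((isBounded_cell b).subset inter_subset_left) ((measurableSet_cell b).inter hU) 2 _
    ((measure_mono inter_subset_left).trans_lt (volume_cell_lt_top b))
  weak := isWeakGrad_gradient (hf.of_le (by norm_cast))

instance isFiniteMeasure_cell_inter :
    IsFiniteMeasure ((volume : Measure (Vec d)).restrict (cell b ∩ U)) :=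
  ⟨by
    rw [Measure.restrict_apply_univ]
    exact (measure_mono inter_subset_left).trans_lt (volume_cell_lt_top b)⟩

theorem locallyIntegrableOn_val (hU : PeriodicSet b U) (hUo : IsOpen U) (p : PerH1 b U) :
    LocallyIntegrableOn p.val U :=
  p.per_val.locallyIntegrableOn hU hUo (p.memLp_val.integrable (by norm_num))

theorem memLp_grad_apply (p : PerH1 b U) (i : Fin d) :
    MemLp (fun y => p.grad y i) 2 (volume.restrict (cell b ∩ U)) :=
  (EuclideanSpace.proj i : Vec d →L[ℝ] ℝ).comp_memLp' p.memLp_grad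

theorem per_grad_apply (p : PerH1 b U) (i : Fin d) : PeriodicOn b U fun y => p.grad y i :=
  fun k y hy => by simp only [p.per_grad k y hy]

/-- The difference of two periodic Sobolev functions. -/
def sub (hU : PeriodicSet b U) (hUo : IsOpen U) (p q : PerH1 b U) : PerH1 b U where
  val := fun y => p.val y - q.val y
  grad := fun y => p.grad y - q.grad y
  per_val := fun i y hy => by simp only [p.per_val i y hy, q.per_val i y hy]
  per_grad := fun i y hy => by simp only [p.per_grad i y hy, q.per_grad i y hy]
  memLp_val := p.memLp_val.sub q.memLp_val
  memLp_grad := p.memLp_grad.sub q.memLp_grad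
  weak := by
    intro φ hφ hc hs i
    have hφ1 : ContDiff ℝ 1 φ := hφ.of_le (by norm_cast)
    have hdc : Continuous fun y => gradient φ y i :=
      (EuclideanSpace.proj i : Vec d →L[ℝ] ℝ).continuous.comp (continuous_gradient hφ1)
    have hcc : HasCompactSupport fun y => gradient φ y i :=
      (hasCompactSupport_gradient hc).comp_left (g := fun v : Vec d => v i) rfl
    have hss : tsupport (fun y => gradient φ y i) ⊆ U :=
      ((tsupport_comp_subset (g := fun v : Vec d => v i) rfl _).trans
        (tsupport_gradient_subset φ)).trans hs
    have hgi : ∀ r : PerH1 b U, LocallyIntegrableOn (fun y => r.grad y i) U := fun r =>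
      (r.per_grad_apply i).locallyIntegrableOn hU hUo
        ((r.memLp_grad_apply i).integrable (by norm_num))
    simp only [sub_mul, PiLp.sub_apply]
    rw [integral_sub
        (integrableOn_mul_of_tsupport_subset (p.locallyIntegrableOn_val hU hUo) hdc hcc hss)
        (integrableOn_mul_of_tsupport_subset (q.locallyIntegrableOn_val hU hUo) hdc hcc hss),
      integral_sub (integrableOn_mul_of_tsupport_subset (hgi p) hφ.continuous hc hs)
        (integrableOn_mul_of_tsupport_subset (hgi q) hφ.continuous hc hs),
      p.weak φ hφ hc hs i, q.weak φ hφ hc hs i]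
    ring

end PerH1

end Sobolev


/-! ### Algebra of the tensor scalar product. -/

section Algebra

variable {d : ℕ}

theorem frob_comm (A B : Tensor d) : frob A B = frob B A := by
  simp only [frob, mul_comm]

theorem frob_add (A B B' : Tensor d) : frob A (B + B') = frob A B + frob A B' := by
  simp only [frob, Matrix.add_apply, mul_add, Finset.sum_add_distrib]

theorem frob_eq_trace (A B : Tensor d) : frob A B = (A * Bᵀ).trace := by
  simp only [frob, Matrix.trace, Matrix.diag_apply, Matrix.mul_apply, Matrix.transpose_apply]

theorem add_frob (A A' B : Tensor d) : frob (A + A') B = frob A B + frob A' B := by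
  rw [frob_comm, frob_add, frob_comm B, frob_comm B]

theorem sub_frob (A A' B : Tensor d) : frob (A - A') B = frob A B - frob A' B := by
  simp only [frob, Matrix.sub_apply, sub_mul, Finset.sum_sub_distrib]

theorem smul_frob (c : ℝ) (A B : Tensor d) : frob (c • A) B = c * frob A B := by
  simp only [frob, Matrix.smul_apply, smul_eq_mul, mul_assoc, Finset.mul_sum]

theorem frob_transpose (A B : Tensor d) : frob Aᵀ Bᵀ = frob A B := by
  simp only [frob, Matrix.transpose_apply]
  exact Finset.sum_comm

theorem frob_one (A : Tensor d) : frob 1 A = A.trace := by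
  rw [frob_eq_trace, one_mul, Matrix.trace_transpose]

theorem frob_symPart {A : Tensor d} (hA : Aᵀ = A) (B : Tensor d) : frob A (symPart B) = frob A B := by
  have h : frob A Bᵀ = frob A B := by
    conv_lhs => rw [← hA]
    exact frob_transpose A B
  rw [symPart, frob_comm, smul_frob, frob_comm, frob_add, h]
  ring

/-- As a sum over quadruples, the left side is carried to the right side by exchanging the index
pairs. This serves the local stiffness and also the homogenized tensor `coefD`. -/
theorem frob_elast_symm {E : Fin d → Fin d → Fin d → Fin d → ℝ}
    (hE : ∀ i j k l, E i j k l = E k l i j) (A B : Tensor d) :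
    frob (Matrix.of fun i j => ∑ k, ∑ l, E i j k l * A k l) B
      = frob (Matrix.of fun i j => ∑ k, ∑ l, E i j k l * B k l) A := by
  simp only [frob, Matrix.of_apply, Finset.sum_mul]
  simp only [← Finset.sum_product', Finset.univ_product_univ]
  refine Fintype.sum_equiv ⟨fun x => (x.2.2.1, x.2.2.2, x.1, x.2.1),
    fun x => (x.2.2.1, x.2.2.2, x.1, x.2.1), fun _ => rfl, fun _ => rfl⟩ _ _ fun x => ?_
  simp only [Equiv.coe_fn_mk, hE x.1]
  ring

end Algebra

/-! ### Symmetry of the cell forms and square integrability of their arguments. -/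

namespace PoroCell

variable {d : ℕ} (C : PoroCell d)

/-- Minor symmetry replaces `Z` by its symmetric part in the elastic term, and major symmetry then
exchanges the arguments. The stress term is a trace invariant under transposition because the stress
is symmetric; the pressure term is built from the symmetric pairings
$\operatorname{tr}X\operatorname{tr}Z$ and $X^T:Z$. -/
theorem tangent_symm (y : Vec d) (X Z : Tensor d) :
    frob (C.tangent y X) Z = frob (C.tangent y Z) X := by
  have h1 : ∀ X Z : Tensor d,
      frob (Matrix.of fun i j => ∑ k, ∑ l, C.elast y i j k l * symPart X k l) Z
        = frob (Matrix.of fun i j => ∑ k, ∑ l, C.elast y i j k l * symPart X k l)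
          (symPart Z) := by
    intro X Z
    refine (frob_symPart ?_ Z).symm
    ext i j
    simp only [Matrix.transpose_apply, Matrix.of_apply, C.elast_minor y i j]
  have h2 : frob (X * C.stress y) Z = frob (Z * C.stress y) X := by
    rw [frob_eq_trace, frob_eq_trace, ← Matrix.trace_transpose, Matrix.transpose_mul,
      Matrix.transpose_mul, Matrix.transpose_transpose, (C.stress_symm y).eq, Matrix.mul_assoc]
  have h3 : frob Xᵀ Z = frob Zᵀ X := by
    rw [← frob_transpose, Matrix.transpose_transpose, frob_comm]
  simp only [tangent, sub_frob, add_frob, smul_frob, frob_one]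
  rw [h1 X Z, h1 Z X, frob_elast_symm (C.elast_major y), h2, h3, mul_comm X.trace]

theorem permH_symm (y : Vec d) : (C.permH y)ᵀ = C.permH y := by
  have h := (C.perm_symm y).eq
  simp only [permH, Matrix.transpose_add, Matrix.transpose_sub, Matrix.transpose_smul,
    Matrix.transpose_mul, Matrix.transpose_transpose, h]
  abel

theorem inner_darcy (P Q : Vec d → Vec d) (y : Vec d) :
    inner ℝ (C.darcy P y) (Q y) = inner ℝ (C.darcy Q y) (P y) := by
  simp only [darcy, EuclideanSpace.inner_eq_star_dotProduct, star_trivial]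
  rw [Matrix.dotProduct_mulVec, ← Matrix.mulVec_transpose, C.permH_symm, dotProduct_comm]

theorem aForm_symm (X Z : Vec d → Tensor d) : C.aForm X Z = C.aForm Z X := by
  simp only [aForm, C.tangent_symm _ (X _)]

theorem cForm_symm (U : Set (Vec d)) (P Q : Vec d → Vec d) : C.cForm U P Q = C.cForm U Q P := by
  simp only [cForm, C.inner_darcy P Q]

/-! ### Integrability -/

/-- The tensor field `X` is square integrable over one cell of the sector `U`. -/
def SqInt (U : Set (Vec d)) (X : Vec d → Tensor d) : Prop :=
  ∀ i j, MemLp (fun y => X y i j) 2 (volume.restrict (C.part U))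

variable {C}

theorem SqInt.add {U : Set (Vec d)} {X Z : Vec d → Tensor d} (hX : C.SqInt U X)
    (hZ : C.SqInt U Z) : C.SqInt U fun y => X y + Z y :=
  fun i j => by
    simp only [Matrix.add_apply]
    exact (hX i j).add (hZ i j)

theorem SqInt.of_univ {X : Vec d → Tensor d} (hX : C.SqInt univ X) (U : Set (Vec d)) :
    C.SqInt U X :=
  fun i j => (hX i j).mono_measure (Measure.restrict_mono
    (inter_subset_inter_right _ (subset_univ U)) le_rfl)

theorem sqInt_jac (u : C.Disp) : C.SqInt univ (jac u) := fun i j => (u i).memLp_grad_apply j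

/-- $\Pi^{ij}$ is linear, so its gradient is constant; hence it is periodic and square integrable
over the cell although $\Pi^{ij}$ itself is not periodic. -/
theorem gradPi_apply (i j : Fin d) (y : Vec d) (k l : Fin d) :
    gradPi i j y k l = gradPi i j 0 k l := by
  let A : Vec d →L[ℝ] Vec d :=
    (EuclideanSpace.proj j : Vec d →L[ℝ] ℝ).smulRight (EuclideanSpace.single i (1 : ℝ))
  have h : Pi i j = A := by
    ext z k
    simp [A, Pi]
  simp only [gradPi, h, ContinuousLinearMap.fderiv, Matrix.of_apply]

theorem sqInt_gradPi (i j : Fin d) : C.SqInt univ (gradPi i j) := by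
  intro k l
  have : IsFiniteMeasure ((volume : Measure (Vec d)).restrict (C.part univ)) :=
    PerH1.isFiniteMeasure_cell_inter
  simp only [gradPi_apply i j _ k l]
  exact memLp_const _

theorem sqInt_gradOm (S : C.Responses) (i j : Fin d) : C.SqInt univ (S.gradOm i j) :=
  (sqInt_jac _).add (sqInt_gradPi i j)

variable (C)

theorem memLp_gradU (k l : Fin d) : MemLp (fun y => C.gradU y k l) ⊤ volume := by
  simp only [gradU, Matrix.add_apply]
  exact (memLp_top_const (C.gradBar k l)).add (C.ubar_bdd k l)

theorem memLp_trace_gradU : MemLp (fun y => (C.gradU y).trace) ⊤ volume :=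
  memLp_finsetSum _ fun i _ => C.memLp_gradU i i

theorem memLp_Bt_add_one (k l : Fin d) : MemLp (fun y => (C.Bt y + 1) k l) ⊤ volume :=
  ((C.memLp_trace_gradU.mul_const ((1 : Tensor d) k l)).sub (C.memLp_gradU l k)).add
    (memLp_top_const _)

theorem memLp_permH (k l : Fin d) : MemLp (fun y => C.permH y k l) ⊤ volume := by
  have hK : ∀ i j, MemLp (fun y => C.perm y i j) ⊤ volume := fun i j => (C.perm_bdd i j).2
  simp only [permH, Matrix.add_apply, Matrix.sub_apply, Matrix.smul_apply, smul_eq_mul,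
    Matrix.mul_apply, Matrix.transpose_apply]
  refine (hK k l).add ((((hK k l).mul' C.memLp_trace_gradU).sub ?_).sub ?_)
  · exact memLp_finsetSum _ fun i _ => (C.memLp_gradU l i).mul' (hK k i)
  · exact memLp_finsetSum _ fun i _ => (hK l i).mul' (C.memLp_gradU k i)

variable {C}

theorem SqInt.memLp_frob {U : Set (Vec d)} {X : Vec d → Tensor d} (hX : C.SqInt U X) :
    MemLp (fun y => frob (C.Bt y + 1) (X y)) 2 (volume.restrict (C.part U)) :=
  memLp_finsetSum _ fun i _ => memLp_finsetSum _ fun j _ =>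
    (hX i j).mul' ((C.memLp_Bt_add_one i j).restrict _)

theorem SqInt.tangent {U : Set (Vec d)} {X : Vec d → Tensor d} (hX : C.SqInt U X) :
    C.SqInt U fun y => C.tangent y (X y) := by
  intro i j
  have hs : ∀ k l, MemLp (fun y => symPart (X y) k l) 2 (volume.restrict (C.part U)) :=
    fun k l => by
      simp only [symPart, Matrix.smul_apply, Matrix.add_apply, Matrix.transpose_apply, smul_eq_mul]
      exact ((hX k l).add (hX l k)).const_mul (1 / 2)
  have htr : MemLp (fun y => (X y).trace) 2 (volume.restrict (C.part U)) :=
    memLp_finsetSum _ fun i _ => hX i i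
  simp only [PoroCell.tangent, Matrix.add_apply, Matrix.sub_apply, Matrix.smul_apply, smul_eq_mul,
    Matrix.mul_apply, Matrix.transpose_apply, Matrix.of_apply]
  have h1 : MemLp (fun y => ∑ k, ∑ l, C.elast y i j k l * symPart (X y) k l) 2
      (volume.restrict (C.part U)) :=
    memLp_finsetSum _ fun k _ => memLp_finsetSum _ fun l _ =>
      (hs k l).mul' ((C.elast_bdd i j k l).2.restrict _)
  have h2 : MemLp (fun y => ∑ k, X y i k * C.stress y k j) 2 (volume.restrict (C.part U)) :=
    memLp_finsetSum _ fun k _ => ((C.stress_bdd k j).2.restrict _).mul' (hX i k)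
  have h3 : MemLp (fun y => (X y).trace * (1 : Tensor d) i j - X y j i) 2
      (volume.restrict (C.part U)) := (htr.mul_const _).sub (hX j i)
  have h4 : MemLp (fun y => C.pres y * ((X y).trace * (1 : Tensor d) i j - X y j i)) 2
      (volume.restrict (C.part U)) := h3.mul' (C.pres_bdd.2.restrict _)
  exact (h1.add h2).sub h4

theorem SqInt.integrable_frob {U : Set (Vec d)} {X Z : Vec d → Tensor d} (hX : C.SqInt U X)
    (hZ : C.SqInt U Z) : IntegrableOn (fun y => frob (X y) (Z y)) (C.part U) := by
  simp only [frob, IntegrableOn]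
  refine integrable_finsetSum _ fun i _ => ?_
  refine integrable_finsetSum _ fun j _ => ?_
  exact (hX i j).integrable_mul (hZ i j)

theorem memLp_darcy {U : Set (Vec d)} {P : Vec d → Vec d}
    (hP : MemLp P 2 (volume.restrict (C.part U))) :
    MemLp (C.darcy P) 2 (volume.restrict (C.part U)) := by
  refine MemLp.of_eval_piLp fun i => ?_
  have h : MemLp (fun y => ∑ j, C.permH y i j * P y j) 2 (volume.restrict (C.part U)) :=
    memLp_finsetSum _ fun j _ => MemLp.mul' ((EuclideanSpace.proj j : Vec d →L[ℝ] ℝ).comp_memLp' hP)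
      ((C.memLp_permH i j).restrict _)
  exact h

theorem aForm_add {X Z Z' : Vec d → Tensor d} (hX : C.SqInt univ X) (hZ : C.SqInt univ Z)
    (hZ' : C.SqInt univ Z') :
    C.aForm X (fun y => Z y + Z' y) = C.aForm X Z + C.aForm X Z' := by
  simp only [aForm, avg, frob_add]
  rw [integral_add (hX.tangent.integrable_frob hZ) (hX.tangent.integrable_frob hZ'), mul_add]

theorem bForm_add {U : Set (Vec d)} {q : Vec d → ℝ} (hq : MemLp q 2 (volume.restrict (C.part U)))
    {X X' : Vec d → Tensor d} (hX : C.SqInt U X) (hX' : C.SqInt U X') :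
    C.bForm U q (fun y => X y + X' y) = C.bForm U q X + C.bForm U q X' := by
  simp only [bForm, avg, frob_add, mul_add]
  have h : ∀ {W}, C.SqInt U W →
      IntegrableOn (fun y => q y * frob (C.Bt y + 1) (W y)) (C.part U) :=
    fun hW => hq.integrable_mul hW.memLp_frob
  rw [integral_add (h hX) (h hX'), mul_add]

theorem memLp_one (U : Set (Vec d)) :
    MemLp (1 : Vec d → ℝ) 2 (volume.restrict (C.part U)) := by
  have : IsFiniteMeasure ((volume : Measure (Vec d)).restrict (C.part U)) :=
    PerH1.isFiniteMeasure_cell_inter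
  exact memLp_const (1 : ℝ)

end PoroCell


/-! ### The matrix sector, traces on the interfaces and periodicity of the coefficients. -/

namespace PoroCell

variable {d : ℕ} (C : PoroCell d)

theorem isOpen_mat : IsOpen C.mat :=
  (isClosed_closure.union isClosed_closure).isOpen_compl

theorem periodicSet_mat : PeriodicSet C.basis C.mat := by
  have h : ∀ α, PeriodicSet C.basis (closure (C.chan α)) := fun α =>
    PeriodicSet.closure fun i y => C.per_chan α i y
  intro i y
  simp only [mat, mem_compl_iff, mem_union, h 0 i y, h 1 i y]

theorem notMem_mat_of_mem_iface {α : Fin 2} {y : Vec d} (hy : y ∈ C.iface α) : y ∉ C.mat := by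
  intro h
  apply h
  fin_cases α
  · exact Or.inl hy.1
  · exact Or.inr hy.1

theorem vol_ne_zero : C.vol ≠ 0 := by
  rw [vol, Measure.real, ENNReal.toReal_ne_zero]
  exact ⟨ZSpan.measure_fundamentalDomain_ne_zero C.basis, (volume_cell_lt_top C.basis).ne⟩

theorem measurableSet_part_iface (α : Fin 2) : MeasurableSet (C.part (C.iface α)) :=
  (measurableSet_cell _).inter (isClosed_closure.inter isClosed_closure).measurableSet

theorem ae_dS_mem_iface (α : Fin 2) : ∀ᵐ y ∂(C.dS α), y ∈ C.iface α := by
  rw [dS]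
  filter_upwards [ae_restrict_mem (C.measurableSet_part_iface α)] with y hy
  exact hy.2

instance isFiniteMeasure_part (U : Set (Vec d)) :
    IsFiniteMeasure ((volume : Measure (Vec d)).restrict (C.part U)) :=
  PerH1.isFiniteMeasure_cell_inter

variable {C}

/-- A smooth periodic function vanishing on the interfaces has zero trace. -/
theorem hasTrace_zero_ofSmooth {f : Vec d → ℝ} (hf : ContDiff ℝ ∞ f)
    (hp : PeriodicOn C.basis univ f) (hz : ∀ y ∉ C.mat, f y = 0) :
    C.HasTrace (PerH1.ofSmooth C.isOpen_mat.measurableSet hf hp) 0 := by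
  refine ⟨fun _ => f, fun _ => ⟨hf, hp⟩, ?_, ?_, fun β => ?_⟩
  · simp [PerH1.ofSmooth]
  · simp [PerH1.ofSmooth]
  · have h : ∀ n : ℕ, eLpNorm (fun y => f y - (0 : Fin 2 → ℝ) β) 2 (C.dS β) = 0 := fun _ => by
      rw [← eLpNorm_zero (p := 2) (μ := C.dS β) (α := Vec d) (ε := ℝ)]
      refine eLpNorm_congr_ae ?_
      filter_upwards [C.ae_dS_mem_iface β] with y hy
      simp [hz y (C.notMem_mat_of_mem_iface hy)]
    exact tendsto_const_nhds.congr fun n => (h n).symm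

theorem tendsto_eLpNorm_sub {E α : Type*} [NormedAddCommGroup E] [MeasurableSpace α]
    {μ : Measure α} {f g : ℕ → α → E} {u v : α → E}
    (hf : ∀ n, AEStronglyMeasurable (fun y => f n y - u y) μ)
    (hg : ∀ n, AEStronglyMeasurable (fun y => g n y - v y) μ)
    (h1 : Tendsto (fun n => eLpNorm (fun y => f n y - u y) 2 μ) atTop (𝓝 0))
    (h2 : Tendsto (fun n => eLpNorm (fun y => g n y - v y) 2 μ) atTop (𝓝 0)) :
    Tendsto (fun n => eLpNorm (fun y => (f n y - g n y) - (u y - v y)) 2 μ) atTop (𝓝 0) := by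
  have h := h1.add h2
  rw [add_zero] at h
  refine tendsto_of_tendsto_of_tendsto_of_le_of_le tendsto_const_nhds h (fun _ => zero_le)
    fun n => ?_
  refine le_trans (le_of_eq ?_) (eLpNorm_sub_le (hf n) (hg n) (by norm_num))
  refine congrArg (fun w => eLpNorm w 2 μ) (funext fun y => ?_)
  simp only [Pi.sub_apply]
  abel

/-- Two functions with the same interface values differ by an admissible test function; this makes
the flux independent of the function chosen to evaluate it. -/
theorem HasTrace.sub {p q : C.Pres} {c e : Fin 2 → ℝ} (hp : C.HasTrace p c)
    (hq : C.HasTrace q e) : C.HasTrace (p.sub C.periodicSet_mat C.isOpen_mat q) (c - e) := by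
  obtain ⟨φ, hφ, h1, h2, h3⟩ := hp
  obtain ⟨ψ, hψ, k1, k2, k3⟩ := hq
  have hs : ∀ {f : Vec d → ℝ}, ContDiff ℝ ∞ f → ContDiff ℝ 1 f := fun h => h.of_le (by norm_cast)
  have hcφ : ∀ n, Continuous (φ n) := fun n => (hφ n).1.continuous
  have hcψ : ∀ n, Continuous (ψ n) := fun n => (hψ n).1.continuous
  refine ⟨fun n y => φ n y - ψ n y, fun n => ⟨(hφ n).1.sub (hψ n).1, fun i y hy => ?_⟩, ?_, ?_,
    fun β => ?_⟩
  · simp only [(hφ n).2 i y hy, (hψ n).2 i y hy]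
  · exact tendsto_eLpNorm_sub
      (fun n => (hcφ n).aestronglyMeasurable.sub p.memLp_val.aestronglyMeasurable)
      (fun n => (hcψ n).aestronglyMeasurable.sub q.memLp_val.aestronglyMeasurable) h1 k1
  · have hg : ∀ n y, gradient (fun z => φ n z - ψ n z) y = gradient (φ n) y - gradient (ψ n) y := by
      intro n y
      rw [gradient, fderiv_fun_sub ((hs (hφ n).1).differentiable one_ne_zero y)
        ((hs (hψ n).1).differentiable one_ne_zero y), map_sub, gradient, gradient]
    simp only [hg]
    exact tendsto_eLpNorm_sub
      (fun n => (continuous_gradient (hs (hφ n).1)).aestronglyMeasurable.sub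
        p.memLp_grad.aestronglyMeasurable)
      (fun n => (continuous_gradient (hs (hψ n).1)).aestronglyMeasurable.sub
        q.memLp_grad.aestronglyMeasurable) h2 k2
  · exact tendsto_eLpNorm_sub
      (fun n => (hcφ n).aestronglyMeasurable.sub aestronglyMeasurable_const)
      (fun n => (hcψ n).aestronglyMeasurable.sub aestronglyMeasurable_const) (h3 β) (k3 β)

variable (C)

theorem periodicOn_gradU : PeriodicOn C.basis univ C.gradU := by
  intro i y hy
  ext k l
  simp only [gradU, jac, Matrix.add_apply, Matrix.of_apply, (C.ubar k).per_grad i y hy]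

theorem periodicOn_permH : PeriodicOn C.basis univ C.permH := by
  intro i y hy
  have h : C.perm (y + C.basis i) = C.perm y := by
    ext k l
    exact (C.perm_bdd k l).1 i y hy
  simp only [permH, h, C.periodicOn_gradU i y hy]

theorem periodicOn_darcy (p : C.Pres) : PeriodicOn C.basis C.mat (C.darcy p.grad) := by
  intro i y hy
  simp only [darcy, C.periodicOn_permH i y (mem_univ y), p.per_grad i y hy]

variable {C}

theorem periodicOn_frob_Bt {X : Vec d → Tensor d} (hX : PeriodicOn C.basis C.mat X) :
    PeriodicOn C.basis C.mat fun y => frob (C.Bt y + 1) (X y) := by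
  intro i y hy
  simp only [Bt, C.periodicOn_gradU i y (mem_univ y), hX i y hy]

theorem periodicOn_jac (u : C.Disp) : PeriodicOn C.basis C.mat (jac u) := by
  intro i y _
  ext k l
  simp only [jac, Matrix.of_apply, (u k).per_grad i y (mem_univ y)]

theorem periodicOn_gradOm (S : C.Responses) (i j : Fin d) :
    PeriodicOn C.basis C.mat (S.gradOm i j) := by
  intro k y hy
  ext m l
  simp only [Responses.gradOm, Matrix.add_apply, periodicOn_jac _ k y hy,
    gradPi_apply i j (y + C.basis k) m l, gradPi_apply i j y m l]

/-! ### The flux of a solution of the matrix problem -/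

section Flux

variable {p : C.Pres} {X : Vec d → Tensor d} {dt : ℝ}

theorem integrableOn_flux {p φ : C.Pres} {D : Vec d → ℝ}
    (hD : MemLp D 2 (volume.restrict (C.part C.mat))) :
    IntegrableOn (fun y => inner ℝ (C.darcy p.grad y) (φ.grad y) + D y * φ.val y)
      (C.part C.mat) :=
  (Integrable.add (f := fun y => inner ℝ (C.darcy p.grad y) (φ.grad y))
    (integrable_inner_of_memLp (memLp_darcy p.memLp_grad) φ.memLp_grad)
    (hD.integrable_mul φ.memLp_val) :)

theorem integral_flux {p φ : C.Pres} {D : Vec d → ℝ}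
    (hD : MemLp D 2 (volume.restrict (C.part C.mat))) :
    ∫ y in C.part C.mat, (inner ℝ (C.darcy p.grad y) (φ.grad y) + D y * φ.val y)
      = (∫ y in C.part C.mat, inner ℝ (C.darcy p.grad y) (φ.grad y))
        + ∫ y in C.part C.mat, D y * φ.val y :=
  integral_add (integrable_inner_of_memLp (memLp_darcy p.memLp_grad) φ.memLp_grad)
    (hD.integrable_mul φ.memLp_val)

/-- The divergence of the flux as prescribed by the diffusion equation in the matrix. -/
def source (C : PoroCell d) (X : Vec d → Tensor d) (dt : ℝ) (y : Vec d) : ℝ :=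
  dt⁻¹ * frob (C.Bt y + 1) (X y)

theorem memLp_source (hX : C.SqInt C.mat X) :
    MemLp (C.source X dt) 2 (volume.restrict (C.part C.mat)) :=
  hX.memLp_frob.const_mul _

theorem periodicOn_source (hXp : PeriodicOn C.basis C.mat X) :
    PeriodicOn C.basis C.mat (C.source X dt) := fun i y hy =>
  congrArg (dt⁻¹ * ·) (periodicOn_frob_Bt hXp i y hy)

/-- The normal trace pairing, with `source` as divergence, is the left side of the diffusion
equation divided by `dt`. -/
theorem avg_flux_source (hX : C.SqInt C.mat X) (φ : C.Pres) :
    C.avg C.mat (fun y => inner ℝ (C.darcy p.grad y) (φ.grad y) + C.source X dt y * φ.val y)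
      = C.cForm C.mat p.grad φ.grad + dt⁻¹ * C.bForm C.mat φ.val X := by
  have h : ∀ y, C.source X dt y * φ.val y = dt⁻¹ * (φ.val y * frob (C.Bt y + 1) (X y)) :=
    fun y => by simp only [source]; ring
  rw [avg, integral_flux (memLp_source hX), cForm, bForm, avg, avg]
  simp only [h]
  rw [integral_const_mul]
  ring

variable (hdt : dt ≠ 0) (hX : C.SqInt C.mat X) (hXp : PeriodicOn C.basis C.mat X)
  (hp : ∀ q : C.Pres, C.HasTrace q 0 →
    C.bForm C.mat q.val X + dt * C.cForm C.mat p.grad q.grad = 0)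

include hdt hX hp

/-- The hypothesis `hp` is common to both matrix problems: `X` will be `gradOm` for the strain
responses and `jac` of $\omega^\alpha$ for the pressure responses. -/
theorem avg_flux_eq_zero {q : C.Pres} (hq : C.HasTrace q 0) :
    C.avg C.mat (fun y => inner ℝ (C.darcy p.grad y) (q.grad y) + C.source X dt y * q.val y)
      = 0 := by
  rw [avg_flux_source hX]
  have h := hp q hq
  field_simp
  linarith

include hXp

/-- The diffusion equation admits only periodic test functions, whereas a weak divergence is tested
with compactly supported ones. The periodization of such a function is smooth and vanishes outside
the matrix sector, so it has zero trace and is admissible; unfolding the cell integrals gives back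
the original test function. -/
theorem isWeakDiv_darcy : IsWeakDiv C.mat (C.darcy p.grad) (C.source X dt) := by
  intro φ hφ hc hs
  have hφ1 : ContDiff ℝ 1 φ := hφ.of_le (by norm_cast)
  have h := avg_flux_eq_zero hdt hX hp (hasTrace_zero_ofSmooth (C := C)
    (contDiff_periodize (b := C.basis) hφ hc) (periodicOn_periodize φ)
    fun y hy => periodize_eq_zero C.periodicSet_mat hs hy)
  rw [avg, mul_eq_zero, or_iff_right (inv_ne_zero C.vol_ne_zero),
    integral_flux (memLp_source hX)] at h
  have h1 := integral_inter_inner_periodize C.periodicSet_mat C.isOpen_mat.measurableSet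
    (C.periodicOn_darcy p) ((memLp_darcy p.memLp_grad).integrable (by norm_num))
    (continuous_gradient hφ1) (hasCompactSupport_gradient hc)
  have h2 := integral_inter_inner_periodize C.periodicSet_mat C.isOpen_mat.measurableSet
    (periodicOn_source (dt := dt) hXp) ((memLp_source hX).integrable (by norm_num))
    hφ.continuous hc
  simp only [PerH1.ofSmooth, gradient_periodize hφ hc] at h
  simp only [RCLike.inner_apply, conj_trivial] at h2
  simp only [mul_comm (C.source X dt _)] at h ⊢
  rw [← h1, ← h2]
  exact eq_neg_of_add_eq_zero_left h

/-- Uniqueness: any admissible divergence agrees a.e. with `source`, and testing with the single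
function `φ` fixes the value. Existence: for another test function `ψ` with the same traces, `ψ - φ`
has zero trace and contributes nothing. -/
theorem isFlux_iff {α : Fin 2} {φ : C.Pres} (hφ : C.HasTrace φ (kron α)) (g : ℝ) :
    C.IsFlux p α g ↔ g = C.cForm C.mat p.grad φ.grad + dt⁻¹ * C.bForm C.mat φ.val X := by
  have hw := isWeakDiv_darcy hdt hX hXp hp
  constructor
  · rintro ⟨D, hDp, hD, hDw, h⟩
    have hae := IsWeakDiv.ae_eq C.isOpen_mat hw hDw
      ((periodicOn_source hXp).locallyIntegrableOn C.periodicSet_mat C.isOpen_mat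
        ((memLp_source hX).integrable (by norm_num)))
      (hDp.locallyIntegrableOn C.periodicSet_mat C.isOpen_mat (hD.integrable (by norm_num)))
    rw [← h φ hφ, ← avg_flux_source hX, avg, avg]
    congr 1
    refine integral_congr_ae ?_
    filter_upwards [ae_restrict_of_ae_restrict_of_subset inter_subset_right hae] with y hy
    rw [hy]
  · rintro rfl
    refine ⟨C.source X dt, periodicOn_source hXp, memLp_source hX, hw, fun ψ hψ => ?_⟩
    rw [← avg_flux_source hX, ← sub_eq_zero, ← avg_flux_eq_zero hdt hX hp
      (q := ψ.sub C.periodicSet_mat C.isOpen_mat φ) (by simpa using hψ.sub hφ), avg, avg, avg,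
      ← mul_sub, ← integral_sub (integrableOn_flux (memLp_source hX))
        (integrableOn_flux (memLp_source hX))]
    congr 3
    ext y
    simp only [PerH1.sub, inner_sub_right]
    ring

theorem flux_eq {α : Fin 2} {φ : C.Pres} (hφ : C.HasTrace φ (kron α)) :
    C.flux p α = C.cForm C.mat p.grad φ.grad + dt⁻¹ * C.bForm C.mat φ.val X :=
  (isFlux_iff hdt hX hXp hp hφ _).1
    (Classical.epsilon_spec ⟨_, (isFlux_iff hdt hX hXp hp hφ _).2 rfl⟩)

end Flux

end PoroCell


/-! ### Passage to the limit in the divergence formula, and the classical surface flux. -/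

/-- Weak continuity of the integral along `L²`-convergent sequences. -/
theorem tendsto_integral_inner {E α : Type*} [NormedAddCommGroup E] [InnerProductSpace ℝ E]
    [MeasurableSpace α] {μ : Measure α} {h u : α → E} {f : ℕ → α → E} (hh : MemLp h 2 μ)
    (hu : MemLp u 2 μ) (hf : ∀ n, MemLp (f n) 2 μ)
    (hlim : Tendsto (fun n => eLpNorm (fun y => f n y - u y) 2 μ) atTop (𝓝 0)) :
    Tendsto (fun n => ∫ y, inner ℝ (h y) (f n y) ∂μ) atTop (𝓝 (∫ y, inner ℝ (h y) (u y) ∂μ)) := by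
  refine tendsto_integral_of_L1' _ (hh.aestronglyMeasurable.inner hu.aestronglyMeasurable)
    (Eventually.of_forall fun n => integrable_inner_of_memLp hh (hf n)) ?_
  have hb := ENNReal.Tendsto.const_mul (a := eLpNorm h 2 μ) hlim (Or.inr hh.eLpNorm_ne_top)
  rw [mul_zero] at hb
  refine tendsto_of_tendsto_of_tendsto_of_le_of_le tendsto_const_nhds hb (fun _ => zero_le)
    fun n => ?_
  -- Cauchy-Schwarz bounds the `L¹` norm of the difference by the product of two `L²` norms, the
  -- second of which tends to zero.
  have hn := eLpNorm_le_eLpNorm_mul_eLpNorm'_of_norm (p := 2) (q := 2) (r := 1)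
    hh.aestronglyMeasurable ((hf n).sub hu).aestronglyMeasurable (fun x y => inner ℝ x y) 1
    (Eventually.of_forall fun y => by
      rw [NNReal.coe_one, one_mul]
      exact norm_inner_le_norm _ _)
  rw [ENNReal.coe_one, one_mul] at hn
  refine le_trans (le_of_eq ?_) hn
  refine congrArg (fun w => eLpNorm w 1 μ) (funext fun y => ?_)
  simp only [Pi.sub_apply, inner_sub_right]

namespace PoroCell

variable {d : ℕ} {C : PoroCell d}

/-- The divergence formula, extended to products of a `C¹` field with a Sobolev function that has
constant traces on the interfaces. -/
theorem surfaceFlux_eq_avg {n F : Vec d → Vec d} (hn : C.IsOuterNormal n) (hF : ContDiff ℝ 1 F)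
    (hFp : PeriodicOn C.basis univ F) {α : Fin 2} {φ : C.Pres} (hφ : C.HasTrace φ (kron α)) :
    C.surfaceFlux F n α
      = C.avg C.mat fun y => inner ℝ (F y) (φ.grad y) + divergence F y * φ.val y := by
  obtain ⟨hfin, hnm, hdiv⟩ := hn
  obtain ⟨ψ, hψ, h1, h2, h3⟩ := hφ
  have hs : ∀ k, ContDiff ℝ 1 (ψ k) := fun k => (hψ k).1.of_le (by norm_cast)
  have hb : Bornology.IsBounded (C.part C.mat) := (isBounded_cell C.basis).subset inter_subset_left
  have hm : MeasurableSet (C.part C.mat) :=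
    (measurableSet_cell _).inter C.isOpen_mat.measurableSet
  have hv : volume (C.part C.mat) < ⊤ :=
    (measure_mono inter_subset_left).trans_lt (volume_cell_lt_top C.basis)
  have hbd : ∀ {E : Type} [NormedAddCommGroup E] {f : Vec d → E}, Continuous f →
      MemLp f 2 (volume.restrict (C.part C.mat)) := fun hf =>
    memLp_of_continuous hf hb hm 2 _ hv
  have hbS : ∀ {E : Type} [NormedAddCommGroup E] {f : Vec d → E} (β : Fin 2), Continuous f →
      MemLp f 2 (C.dS β) := fun β hf =>
    memLp_of_continuous hf ((isBounded_cell C.basis).subset inter_subset_left)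
      (C.measurableSet_part_iface β) 2 _ (by simpa [dS, part] using hfin β)
  -- Since the normal has length one, `F · n` is dominated by the norm of `F`, which is bounded on
  -- one period of the interface.
  have hFn : ∀ β, MemLp (fun y => inner ℝ (F y) (n y)) 2 (C.dS β) := fun β => by
    refine (hbS β hF.continuous).of_le (hF.continuous.aestronglyMeasurable.inner (hnm β).1) ?_
    filter_upwards [(hnm β).2] with y hy
    simpa [hy] using norm_inner_le_norm (𝕜 := ℝ) (F y) (n y)
  have hvol : Tendsto (fun k => (∫ y in C.part C.mat, inner ℝ (F y) (gradient (ψ k) y))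
      + ∫ y in C.part C.mat, inner ℝ (divergence F y) (ψ k y)) atTop
      (𝓝 ((∫ y in C.part C.mat, inner ℝ (F y) (φ.grad y))
        + ∫ y in C.part C.mat, inner ℝ (divergence F y) (φ.val y))) :=
    (tendsto_integral_inner (hbd hF.continuous) φ.memLp_grad
      (fun k => hbd (continuous_gradient (hs k))) h2).add
    (tendsto_integral_inner (hbd (continuous_divergence hF)) φ.memLp_val
      (fun k => hbd (hs k).continuous) h1)
  have hsurf : Tendsto (fun k => ∑ β, ∫ y, inner ℝ (inner ℝ (F y) (n y)) (ψ k y) ∂(C.dS β)) atTop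
      (𝓝 (∑ β, ∫ y, inner ℝ (inner ℝ (F y) (n y)) (kron α β) ∂(C.dS β))) :=
    tendsto_finsetSum _ fun β _ => tendsto_integral_inner (hFn β) (hbS β continuous_const)
      (fun k => hbS β (hs k).continuous) (h3 β)
  have heq : ∀ k, (∫ y in C.part C.mat, inner ℝ (F y) (gradient (ψ k) y))
      + ∫ y in C.part C.mat, inner ℝ (divergence F y) (ψ k y)
      = ∑ β, ∫ y, inner ℝ (inner ℝ (F y) (n y)) (ψ k y) ∂(C.dS β) := by
    intro k
    rw [← integral_add
      (integrable_inner_of_memLp (hbd hF.continuous) (hbd (continuous_gradient (hs k))))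
      (integrable_inner_of_memLp (hbd (continuous_divergence hF)) (hbd (hs k).continuous))]
    -- The smooth approximants of `φ` may multiply `F` in the divergence formula; `φ` itself may
    -- not, being only Sobolev.
    have h := hdiv (fun z => ψ k z • F z) ((hs k).smul hF) fun i y hy => by
      simp only [(hψ k).2 i y hy, hFp i y hy]
    simp only [real_inner_smul_left] at h
    simp only [RCLike.inner_apply, conj_trivial]
    rw [← h]
    refine integral_congr_ae (Eventually.of_forall fun y => ?_)
    exact (divergence_smul (hs k) hF y).symm
  simp only [heq] at hvol
  have hlim := tendsto_nhds_unique hvol hsurf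
  -- The limit traces are 1 on $\Gamma_\alpha$ and 0 on the other interface, so a single surface
  -- integral remains.
  rw [Finset.sum_eq_single α (fun β _ hβ => by simp [kron, hβ]) (by simp)] at hlim
  rw [← integral_add (integrable_inner_of_memLp (hbd hF.continuous) φ.memLp_grad)
    (integrable_inner_of_memLp (hbd (continuous_divergence hF)) φ.memLp_val)] at hlim
  simp only [RCLike.inner_apply, conj_trivial, kron, Pi.single_eq_same, one_mul,
    mul_comm (φ.val _)] at hlim
  rw [surfaceFlux, avg, hlim]

/-- The classical surface integral agrees with the flux. -/
theorem surfaceFlux_eq_flux {p : C.Pres} {X : Vec d → Tensor d} {dt : ℝ} (hdt : dt ≠ 0)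
    (hX : C.SqInt C.mat X) (hXp : PeriodicOn C.basis C.mat X)
    (hp : ∀ q : C.Pres, C.HasTrace q 0 →
      C.bForm C.mat q.val X + dt * C.cForm C.mat p.grad q.grad = 0)
    {n F : Vec d → Vec d} (hn : C.IsOuterNormal n) (hF : ContDiff ℝ 1 F)
    (hFp : PeriodicOn C.basis univ F)
    (hFd : ∀ᵐ y ∂(volume.restrict C.mat), F y = C.darcy p.grad y)
    {α : Fin 2} {φ : C.Pres} (hφ : C.HasTrace φ (kron α)) :
    C.surfaceFlux F n α = C.flux p α := by
  -- Both `source` and the pointwise divergence of `F` are weak divergences of the same field, hence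
  -- equal a.e.
  have hae := IsWeakDiv.ae_eq C.isOpen_mat ((isWeakDiv_darcy hdt hX hXp hp).congr hFd)
    (isWeakDiv_divergence hF)
    ((periodicOn_source hXp).locallyIntegrableOn C.periodicSet_mat C.isOpen_mat
      ((memLp_source hX).integrable (by norm_num)))
    ((continuous_divergence hF).locallyIntegrable.locallyIntegrableOn _)
  rw [surfaceFlux_eq_avg hn hF hFp hφ, flux_eq hdt hX hXp hp hφ, ← avg_flux_source hX, avg, avg]
  congr 1
  refine integral_congr_ae ?_
  filter_upwards [ae_restrict_of_ae_restrict_of_subset inter_subset_right hae,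
    ae_restrict_of_ae_restrict_of_subset inter_subset_right hFd] with y h1 h2
  rw [h1, h2]

/-! ### Reciprocity of the cell responses and symmetry of the homogenized coefficients. -/

namespace Responses

variable {S : C.Responses} {dt : ℝ}

/-- The response $\pi^\alpha$ supplies the function with trace 1 on $\Gamma_\alpha$ and 0 on the
other interface, without which the defining condition of the flux could be void. -/
theorem isFlux_pi_iff (hdt : dt ≠ 0) (hS : S.Solves dt) (i j : Fin d) (α : Fin 2) (g : ℝ) :
    C.IsFlux (S.pi i j) α g ↔ g = C.flux (S.pi i j) α := by
  have hX := (sqInt_gradOm S i j).of_univ C.mat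
  rw [isFlux_iff hdt hX (periodicOn_gradOm S i j) (hS.1 i j).2.2 (hS.2.1 α).1,
    flux_eq hdt hX (periodicOn_gradOm S i j) (hS.1 i j).2.2 (hS.2.1 α).1]

theorem isFlux_piA_iff (hdt : dt ≠ 0) (hS : S.Solves dt) (α β : Fin 2) (g : ℝ) :
    C.IsFlux (S.piA β) α g ↔ g = C.flux (S.piA β) α := by
  have hX := (sqInt_jac (S.omA β)).of_univ C.mat
  rw [isFlux_iff hdt hX (periodicOn_jac _) (hS.2.1 β).2.2 (hS.2.1 α).1,
    flux_eq hdt hX (periodicOn_jac _) (hS.2.1 β).2.2 (hS.2.1 α).1]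

theorem aForm_gradOm (S : C.Responses) {X : Vec d → Tensor d} (hX : C.SqInt univ X) (i j : Fin d) :
    C.aForm X (S.gradOm i j) = C.aForm X (jac (S.om i j)) + C.aForm X (gradPi i j) :=
  aForm_add hX (sqInt_jac _) (sqInt_gradPi i j)

theorem bForm_gradOm (S : C.Responses) {U : Set (Vec d)} {q : Vec d → ℝ}
    (hq : MemLp q 2 (volume.restrict (C.part U))) (i j : Fin d) :
    C.bForm U q (S.gradOm i j) = C.bForm U q (jac (S.om i j)) + C.bForm U q (gradPi i j) :=
  bForm_add hq ((sqInt_jac _).of_univ U) ((sqInt_gradPi i j).of_univ U)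

theorem coefB_eq_coefR (hdt : dt ≠ 0) (hS : S.Solves dt) (α : Fin 2) (i j : Fin d) :
    S.coefB α i j = S.coefR dt α i j := by
  obtain ⟨h0, h1, h2⟩ := hS.1 i j
  obtain ⟨k0, k1, k2⟩ := hS.2.1 α
  -- Crossed tests: the strain equilibrium with $\omega^\alpha$, the pressure equilibrium with
  -- $\omega^{ij}$, and the pressure diffusion with $\pi^{ij}$, which is admissible by its zero
  -- trace. The missing test of the strain diffusion with $\pi^\alpha$ is replaced by the flux
  -- formula `e4`.
  have e1 := h1 (S.omA α)
  have e2 := k1 (S.om i j)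
  have e3 := k2 (S.pi i j) h0
  have e4 := flux_eq hdt ((sqInt_gradOm S i j).of_univ C.mat) (periodicOn_gradOm S i j) h2 k0
  have e5 := aForm_gradOm S (sqInt_jac (S.omA α)) i j
  have e6 := bForm_gradOm S (S.piA α).memLp_val i j
  have e7 := bForm_gradOm S (memLp_one (C.chan α)) i j
  rw [C.aForm_symm] at e1
  rw [C.cForm_symm] at e3
  rw [coefB, coefR, e4, e7, mul_add dt, mul_inv_cancel_left₀ hdt, e6]
  congr 1
  linarith

/-- Testing the equilibrium of the pair $kl$ with $\omega^{ij}$ completes $\Pi^{ij}$ to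
$\omega^{ij}+\Pi^{ij}$; testing the diffusion of the pair $ij$ with $\pi^{kl}$ turns the coupling
term into dissipation. The result is a symmetric energy. -/
theorem coefD_eq (hS : S.Solves dt) (i j k l : Fin d) :
    S.coefD i j k l = C.vol⁻¹ * (C.aForm (S.gradOm k l) (S.gradOm i j)
      + dt * C.cForm C.mat (S.pi i j).grad (S.pi k l).grad) := by
  have e1 := (hS.1 k l).2.1 (S.om i j)
  have e2 := (hS.1 i j).2.2 (S.pi k l) (hS.1 k l).1
  have e3 := aForm_gradOm S (sqInt_gradOm S k l) i j
  have e4 := bForm_gradOm S (S.pi k l).memLp_val i j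
  rw [coefD]
  congr 1
  linarith

theorem coefD_symm (hS : S.Solves dt) (i j k l : Fin d) :
    S.coefD i j k l = S.coefD k l i j := by
  rw [coefD_eq hS, coefD_eq hS, C.aForm_symm, C.cForm_symm]

/-- The flux evaluated on $\pi^\alpha$ contributes $b_3(\pi^\alpha,\omega^\beta)$, which together
with $b_\alpha(1,\omega^\beta)$ is $a(\omega^\alpha,\omega^\beta)$ by the equilibrium of
$\omega^\alpha$. -/
theorem coefG_eq (hdt : dt ≠ 0) (hS : S.Solves dt) (α β : Fin 2) :
    S.coefG dt α β = C.vol⁻¹ * (C.cForm C.mat (S.piA β).grad (S.piA α).grad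
      + dt⁻¹ * C.aForm (jac (S.omA α)) (jac (S.omA β))) := by
  rw [coefG, flux_eq hdt ((sqInt_jac (S.omA β)).of_univ C.mat) (periodicOn_jac _) (hS.2.1 β).2.2
    (hS.2.1 α).1, ← (hS.2.1 α).2.1 (S.omA β)]
  ring

theorem coefG_symm (hdt : dt ≠ 0) (hS : S.Solves dt) (α β : Fin 2) :
    S.coefG dt α β = S.coefG dt β α := by
  rw [coefG_eq hdt hS, coefG_eq hdt hS, C.aForm_symm, C.cForm_symm]

theorem coefC_symm (S : C.Responses) (α : Fin 2) (i j : Fin d) :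
    S.coefC α i j = S.coefC α j i := by
  rw [coefC, coefC, C.cForm_symm]

/-- The integrand of the homogenized system is a symmetric bilinear expression. -/
theorem equilibrium_sub_diffusion_symm (hdt : dt ≠ 0) (hS : S.Solves dt) (X Z : Tensor d)
    (p q : Fin 2 → ℝ) (P Q : Fin 2 → Vec d) :
    S.equilibrium X p Z - ∑ α, S.diffusion dt α X p P (q α) (Q α)
      = S.equilibrium Z q X - ∑ α, S.diffusion dt α Z q Q (p α) (P α) := by
  have hD : (∑ i, ∑ j, ∑ k, ∑ l, S.coefD i j k l * X k l * Z i j)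
      = ∑ i, ∑ j, ∑ k, ∑ l, S.coefD i j k l * Z k l * X i j := by
    have h := frob_elast_symm (E := S.coefD) (coefD_symm hS) X Z
    simpa only [frob, Matrix.of_apply, Finset.sum_mul] using h
  -- Once the two coupling tensors coincide, the coupling terms of the equilibrium equation and of
  -- the diffusion equations are exchanged with each other.
  have hB : ∀ α i j, S.coefR dt α i j = S.coefB α i j := fun α i j =>
    (coefB_eq_coefR hdt hS α i j).symm
  have hC : ∀ α, (∑ i, ∑ j, S.coefC α i j * P α j * Q α i)
      = ∑ i, ∑ j, S.coefC α i j * Q α j * P α i := by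
    intro α
    rw [Finset.sum_comm]
    refine Finset.sum_congr rfl fun i _ => Finset.sum_congr rfl fun j _ => ?_
    rw [coefC_symm S α j i]
    ring
  simp only [equilibrium, diffusion, hB, hD, hC, Fin.sum_univ_two, coefG_symm hdt hS 1 0]
  ring

end Responses

end PoroCell

end Poro

end

theorem mainTheorem2 {d : ℕ} (Ω : Set (Poro.Vec d)) (hΩ : IsOpen Ω) (dt : ℝ) (hdt : 0 < dt)
    (C : Poro.Vec d → Poro.PoroCell d) (S : ∀ x, (C x).Responses)
    (hS : ∀ x ∈ Ω, (S x).Solves dt) :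
    -- the interface fluxes in the coefficients are well defined
    (∀ x ∈ Ω, ∀ α : Fin 2,
      (∀ i j, ∀ g, (C x).IsFlux ((S x).pi i j) α g ↔ g = (C x).flux ((S x).pi i j) α) ∧
      (∀ β, ∀ g, (C x).IsFlux ((S x).piA β) α g ↔ g = (C x).flux ((S x).piA β) α)) ∧
    -- equality of the coupling tensors
    (∀ x ∈ Ω, ∀ α i j, (S x).coefB α i j = (S x).coefR dt α i j) ∧
    -- the same with the surface integral, if the flux field is continuously differentiable
    -- up to the interface
    (∀ x ∈ Ω, ∀ n : Poro.Vec d → Poro.Vec d, (C x).IsOuterNormal n →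
      ∀ α i j, ∀ F : Poro.Vec d → Poro.Vec d, ContDiff ℝ 1 F →
        Poro.PeriodicOn (C x).basis Set.univ F →
        (∀ᵐ y ∂(MeasureTheory.volume.restrict (C x).mat),
          F y = (C x).darcy ((S x).pi i j).grad y) →
        (S x).coefB α i j = (C x).vol⁻¹ *
          ((C x).bForm ((C x).chan α) 1 ((S x).gradOm i j) + dt * (C x).surfaceFlux F n α)) ∧
    -- symmetry of the homogenized system
    (∀ x ∈ Ω, (∀ i j k l, (S x).coefD i j k l = (S x).coefD k l i j) ∧
      (∀ α β, (S x).coefG dt α β = (S x).coefG dt β α) ∧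
      (∀ α i j, (S x).coefC α i j = (S x).coefC α j i)) ∧
    (∀ (u v : Fin d → Poro.H1 Ω) (p q : Fin 2 → Poro.H1 Ω),
      Poro.macroForm C S dt u p v q = Poro.macroForm C S dt v q u p) := by
  have hdt0 : dt ≠ 0 := hdt.ne'
  refine ⟨fun x hx α => ⟨fun i j g => Poro.PoroCell.Responses.isFlux_pi_iff hdt0 (hS x hx) i j α g,
      fun β g => Poro.PoroCell.Responses.isFlux_piA_iff hdt0 (hS x hx) α β g⟩,
    fun x hx α i j => Poro.PoroCell.Responses.coefB_eq_coefR hdt0 (hS x hx) α i j, ?_,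
    fun x hx => ⟨Poro.PoroCell.Responses.coefD_symm (hS x hx),
      Poro.PoroCell.Responses.coefG_symm hdt0 (hS x hx), Poro.PoroCell.Responses.coefC_symm (S x)⟩,
    fun u v p q => ?_⟩
  · intro x hx n hn α i j F hF hFp hFd
    rw [Poro.PoroCell.Responses.coefB_eq_coefR hdt0 (hS x hx), Poro.PoroCell.Responses.coefR,
      Poro.PoroCell.surfaceFlux_eq_flux hdt0
        ((Poro.PoroCell.sqInt_gradOm (S x) i j).of_univ _)
        (Poro.PoroCell.periodicOn_gradOm (S x) i j) ((hS x hx).1 i j).2.2 hn hF hFp hFd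
        ((hS x hx).2.1 α).1]
  -- The two integrands agree at every point of `Ω`, so no integrability of the coefficients in the
  -- macroscopic variable enters.
  · refine setIntegral_congr_fun hΩ.measurableSet fun x hx => ?_
    exact Poro.PoroCell.Responses.equilibrium_sub_diffusion_symm hdt0 (hS x hx) _ _ _ _
      (fun β => (p β).grad x) fun β => (q β).grad x
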